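/- **Embeddings.** Let $G=(V,E)$ be a finite connected simple graph with at least one edge, and let $T$ be a spanning tree of $G$. A general rotation system $(\rho,\lambda)$ of $G$ consists of a cyclic permutation $\rho_v$ of the edges incident to $v$, for every vertex $v$, and a map $\lambda:E\to\{0,1\}$ ($e$ is twisted if $\lambda(e)=1$). It determines a cellular embedding of $G$ into a closed surface. With $F$ the set of faces, the Euler genus of the surface is $2-|V|+|E|-|F|$ (it equals $2j$ for the orientable surface with $j$ handles and $k$ for the nonorientable surface with $k$ crosscaps). $(\rho,\lambda)$ is a $T$-rotation system if $\lambda(e)=0$ for all $e\in E(T)$. Let $\varepsilon_G(i)$ be the number of $T$-rotation systems of $G$ whose surface has Euler genus $i$. The Euler-genus polynomial of $G$ is $\mathcal E_G(z)=\sum_{i\ge 0}\varepsilon_G(i)z^i$. **Graphs.** Let $k\ge 2$, $m_1,\dots,m_{k-1}\ge 1$ and $m_k\ge 0$. Take a horizontal path $v_0,v_1,\dots,v_{\ell+1}$ with $\ell=m_1+\dots+m_k+k-2$, and attach a pendant edge $v_iu_i$ at each $v_i$, $1\le i\le \ell$, pointing up or down, so that from left to right there are first $m_1$ edges up, then $m_2+1$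 down, then $m_3+1$ up, and so on, alternating, the $i$-th group having $m_i+1$ edges for $1<i<k$ and the last group having $m_k$ edges. The graph $H_{m_1,\dots,m_k}$ arises from this plane tree by adding the cycle that passes through its leaves in their order around the tree: from $v_0$ through the upper leaves from left to right to $v_{\ell+1}$, then through the lower leaves from right to left back to $v_0$. **Matrices.** For $n\geq 0$, $a\in\mathbb Z_2^n$ and $b\in\mathbb Z_2^{n-1}$ let $\mathcal L_n^{a,b}$ be the symmetric tridiagonal $n\times n$ matrix over $\mathbb Z_2$ with diagonal $a_1,\dots,a_n$ and off-diagonal $b_1,\dots,b_{n-1}$. Let $\mathbf x_0\in\mathbb Z_2^k$, $\mathbf y_0\in\mathbb Z_2^{k-1}$ and, for $1\le i\le k$, $\mathbf x_i\in \mathbb Z_2^{m_i}$, $\mathbf y_i\in\mathbb Z_2^{m_i-1}$ and $\mathbf z_i=(z_{i,0},z_{i,1},\dots,z_{i,m_i+1})\in\mathbb Z_2^{m_i+2}$ (the entries $z_{1,0}$ and $z_{k,m_k+1}$ will not occur). Let $$\Delta^{X,Y,Z}_{m_1,\dots,m_k}=\begin{bmatrix}\mathcal L_k^{\mathbf x_0,\mathbf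 y_0}&M_1^T&\cdots&M_k^T\\ M_1&\mathcal L_{m_1}^{\mathbf x_1,\mathbf y_1}&&\mathbf 0\\ \vdots&&\ddots&\\ M_k&\mathbf 0&&\mathcal L_{m_k}^{\mathbf x_k,\mathbf y_k}\end{bmatrix},$$ where $M_i$ is the $m_i\times k$ matrix over $\mathbb Z_2$ whose $i$-th column is $(z_{i,1},\dots,z_{i,m_i})^T$, whose $(i-1)$-st column (if $i\ge2$) is $(z_{i-1,m_{i-1}+1},0,\dots,0)^T$, whose $(i+1)$-st column (if $i\le k-1$) is $(0,\dots,0,z_{i+1,0})^T$, and whose other columns are zero. Let $\delta_{m_1,\dots,m_k}[j]$ be the number of matrices of the form $\Delta^{X,Y,Z}_{m_1,\dots,m_k}$ that have rank $j$ over $\mathbb Z_2$, and let $\delta_{m_1,\dots,m_k}(z)=\sum_{j=0}^{k+m_1+\dots+m_k}\delta_{m_1,\dots,m_k}[j]z^j$. **Theorem.** For all $k\ge2$, $m_1,\dots,m_{k-1}\ge1$, $m_k\ge0$, and for every choice of the spanning tree $T$, the Euler-genus polynomial of $H_{m_1,\dots,m_k}$ is $$\mathcal E_{H_{m_1,\dots,m_k}}(z)=2\,\delta_{m_1,\dots,m_k}(z).$$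 -/

import Mathlib

/-! ### Rotation systems, faces and the Euler-genus polynomial -/

/-- A general rotation system `(ρ, λ)` of a graph: `rot v` is a cyclic permutation of the edges
incident to `v` (in a simple graph these correspond to the neighbours of `v`), and an edge `e` is
twisted if `twist e = 1` and untwisted if `twist e = 0`. -/
structure GeneralRotationSystem {V : Type*} (G : SimpleGraph V) where
  rot : ∀ v : V, Equiv.Perm (G.neighborSet v)
  rot_cyclic : ∀ v : V, (rot v).IsCycleOn Set.univ
  twist : G.edgeSet → ZMod 2

namespace GeneralRotationSystem

variable {V : Type*} {G : SimpleGraph V}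

/-- The dart that follows `d` in the rotation at its initial vertex. -/
def next (R : GeneralRotationSystem G) (d : G.Dart) : G.Dart :=
  ⟨(d.fst, (R.rot d.fst ⟨d.snd, d.adj⟩ : V)), (R.rot d.fst ⟨d.snd, d.adj⟩).2⟩

/-- The band decomposition of the surface has a disc for every vertex and a band for every edge.
The flag `(d, s)` is the end at the vertex `d.fst` of one of the two long sides of the band of
`d.edge`: the one facing the next edge of the rotation at `d.fst` if `s = 0`, and the one facing
the previous edge if `s = 1`. `Step` relates flags that are consecutive on the boundary. -/
inductive Step (R : GeneralRotationSystem G) : G.Dart × ZMod 2 → G.Dart × ZMod 2 → Prop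
  /-- Follow a long side of the band to its other end. Seen from there, the side is the opposite
  one if the edge is untwisted, and the same one if it is twisted. -/
  | side (d : G.Dart) (s : ZMod 2) : Step R (d, s) (d.symm, s + R.twist ⟨d.edge, d.edge_mem⟩ + 1)
  /-- Follow the boundary of the disc of the vertex, from a band to the next one. -/
  | corner (d : G.Dart) : Step R (d, 0) (R.next d, 1)

/-- The faces: the boundary components of the band decomposition, that is the classes of flags
under the equivalence relation generated by `Step`. -/
def Face (R : GeneralRotationSystem G) : Type _ := Quot R.Step

/-- The Euler characteristic `|V| - |E| + |F|` of the surface (of a connected graph with at least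
one edge). -/
noncomputable def eulerChar (R : GeneralRotationSystem G) : ℤ :=
  (Nat.card V : ℤ) - (Nat.card G.edgeSet : ℤ) + (Nat.card R.Face : ℤ)

/-- The surface has Euler genus `i`, that is Euler characteristic `2 - i`. (The orientable surface
with `j` handles has Euler genus `2 * j` and Euler characteristic `2 - 2 * j`; the nonorientable
surface with `k` crosscaps has Euler genus `k` and Euler characteristic `2 - k`.) -/
def HasEulerGenus (R : GeneralRotationSystem G) (i : ℕ) : Prop :=
  R.eulerChar = 2 - (i : ℤ)

/-- `T`-rotation systems: no edge of `T` is twisted. -/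
def IsTRotationSystem (R : GeneralRotationSystem G) (T : SimpleGraph V) : Prop :=
  ∀ e : G.edgeSet, (e : Sym2 V) ∈ T.edgeSet → R.twist e = 0

end GeneralRotationSystem

/-- The number of embeddings of `G` into surfaces of Euler genus `i`, embeddings being counted by
their `T`-rotation systems for a spanning tree `T` of `G`. -/
noncomputable def embeddingCount {V : Type*} (G T : SimpleGraph V) (i : ℕ) : ℕ :=
  Nat.card {R : GeneralRotationSystem G // R.IsTRotationSystem T ∧ R.HasEulerGenus i}

/-- The Euler-genus polynomial `∑ i, embeddingCount G T i * z ^ i`. The sum may be cut off at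
`|E| + 2`, see `coeff_eulerGenusPolynomial`. -/
noncomputable def eulerGenusPolynomial {V : Type*} (G T : SimpleGraph V) : Polynomial ℕ :=
  ∑ i ∈ Finset.range (Nat.card G.edgeSet + 3), Polynomial.monomial i (embeddingCount G T i)

theorem coeff_eulerGenusPolynomial {V : Type*} (G T : SimpleGraph V) (i : ℕ) :
    (eulerGenusPolynomial G T).coeff i = embeddingCount G T i := by
  simp only [eulerGenusPolynomial, Polynomial.finsetSum_coeff, Polynomial.coeff_monomial,
    Finset.sum_ite_eq', Finset.mem_range]
  split_ifs with h
  · rfl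
  · symm
    have : IsEmpty {R : GeneralRotationSystem G // R.IsTRotationSystem T ∧ R.HasEulerGenus i} := by
      refine ⟨fun R => ?_⟩
      have hR : R.1.eulerChar = 2 - (i : ℤ) := R.2.2
      unfold GeneralRotationSystem.eulerChar at hR
      omega
    simp [embeddingCount]

/-! ### Cubic caterpillar-Halin graphs -/

/-- The cubic Halin graph of a caterpillar with spine `v_1, …, v_ℓ`, where `up i` says whether the
pendant edge at the `i`-th spine vertex points up or down.
`Sum.inl i` is the spine vertex `v_{i+1}`, and `Sum.inr j` is the leaf `u_j`, `0 ≤ j ≤ ℓ + 1`, where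
`u_0 = v_0` and `u_{ℓ+1} = v_{ℓ+1}` are the two ends of the horizontal path.
The leaves lie on a cycle, which goes above from `u_0` through the up leaves from left to right to
`u_{ℓ+1}`, and below through the down leaves from right to left back to `u_0`. -/
def caterpillarHalin {ℓ : ℕ} (up : Fin ℓ → Bool) : SimpleGraph (Fin ℓ ⊕ Fin (ℓ + 2)) :=
  -- `onSide s j`: the leaf `u_j` lies on the upper (`s = true`) or lower (`s = false`) half of the
  -- cycle, the two ends lying on both
  let onSide (s : Bool) (j : Fin (ℓ + 2)) : Prop :=
    j.val = 0 ∨ j.val = ℓ + 1 ∨ ∃ i : Fin ℓ, i.val + 1 = j.val ∧ up i = s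
  SimpleGraph.fromRel fun a b => match a, b with
    | .inl i, .inl j => i.val + 1 = j.val
    | .inl i, .inr j => j.val = i.val + 1 ∨ (i.val = 0 ∧ j.val = 0) ∨
        (i.val + 1 = ℓ ∧ j.val = ℓ + 1)
    | .inr _, .inl _ => False
    | .inr j, .inr j' => ∃ s : Bool, onSide s j ∧ onSide s j' ∧ j < j' ∧
        ∀ t : Fin (ℓ + 2), j < t → t < j' → ¬ onSide s t

/-- The lengths `m_1, m_2 + 1, …, m_{k-1} + 1, m_k` of the maximal runs of consecutive up or down
edges. -/
def runLength {k : ℕ} (m : Fin k → ℕ) (i : Fin k) : ℕ :=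
  if i.val = 0 ∨ i.val + 1 = k then m i else m i + 1

/-- The sequence of the directions of the pendant edges, from left to right; `true` means up. -/
def directions {k : ℕ} (m : Fin k → ℕ) : List Bool :=
  (List.ofFn fun i : Fin k => List.replicate (runLength m i) (decide (Even i.val))).flatten

/-- The cubic caterpillar-Halin graph `H_{m_1, …, m_k}`. -/
def graphH {k : ℕ} (m : Fin k → ℕ) :
    SimpleGraph (Fin (directions m).length ⊕ Fin ((directions m).length + 2)) :=
  caterpillarHalin fun i => (directions m).get i

/-! ### The matrices -/

/-- The symmetric tridiagonal matrix `L_n^{a,b}` with diagonal `a` and off-diagonal `b`. -/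
def tridiag (n : ℕ) (a : Fin n → ZMod 2) (b : Fin (n - 1) → ZMod 2) :
    Matrix (Fin n) (Fin n) (ZMod 2) :=
  Matrix.of fun i j =>
    if i = j then a i
    else if h : i.val + 1 = j.val then b ⟨i.val, by omega⟩
    else if h : j.val + 1 = i.val then b ⟨j.val, by omega⟩
    else 0

/-- The blocks `M_1, …, M_k`, stacked on top of each other; `⟨i, l⟩` is row `l + 1` of `M_i`.
Of `z_i = (z_{i,0}, …, z_{i,m_i+1})`, the entry `z_{i,0}` for the first `i` and the entry
`z_{i,m_i+1}` for the last `i` do not occur. -/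
def blockM {k : ℕ} (m : Fin k → ℕ) (z : ∀ i : Fin k, Fin (m i + 2) → ZMod 2) :
    Matrix (Σ i : Fin k, Fin (m i)) (Fin k) (ZMod 2) :=
  Matrix.of fun r j =>
    if j = r.1 then z r.1 ⟨r.2.val + 1, by omega⟩
    else if j.val + 1 = r.1.val ∧ r.2.val = 0 then z j (Fin.last (m j + 1))
    else if r.1.val + 1 = j.val ∧ r.2.val + 1 = m r.1 then z j 0
    else 0

/-- The matrix `Δ_{m_1, …, m_k}^{X,Y,Z}`. -/
def overlapForm {k : ℕ} (m : Fin k → ℕ)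
    (x₀ : Fin k → ZMod 2) (y₀ : Fin (k - 1) → ZMod 2)
    (x : ∀ i : Fin k, Fin (m i) → ZMod 2) (y : ∀ i : Fin k, Fin (m i - 1) → ZMod 2)
    (z : ∀ i : Fin k, Fin (m i + 2) → ZMod 2) :
    Matrix (Fin k ⊕ Σ i : Fin k, Fin (m i)) (Fin k ⊕ Σ i : Fin k, Fin (m i)) (ZMod 2) :=
  Matrix.fromBlocks (tridiag k x₀ y₀) (blockM m z).transpose (blockM m z)
    (Matrix.blockDiagonal' fun i => tridiag (m i) (x i) (y i))

/-- The number of matrices of the form `Δ_{m_1, …, m_k}^{X,Y,Z}` that have rank `j`. -/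
noncomputable def deltaCount {k : ℕ} (m : Fin k → ℕ) (j : ℕ) : ℕ :=
  Set.ncard {A : Matrix (Fin k ⊕ Σ i : Fin k, Fin (m i)) (Fin k ⊕ Σ i : Fin k, Fin (m i))
      (ZMod 2) | (∃ x₀ y₀ x y z, A = overlapForm m x₀ y₀ x y z) ∧ A.rank = j}

/-- The polynomial `δ_{m_1, …, m_k}(z)`. -/
noncomputable def deltaPolynomial {k : ℕ} (m : Fin k → ℕ) : Polynomial ℕ :=
  ∑ j ∈ Finset.range (k + ∑ i, m i + 1), Polynomial.monomial j (deltaCount m j)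

/-! The graph is cubic and plane, and every embedding is compared with the plane one. Let I be the
set of inner faces of the plane embedding. A trivalent vertex has only two rotations, so a rotation
system is a pair (S, λ), where S ∈ Z₂^V records the reversed rotations and λ the twists. Only the
class μ = λ + δS + ε (`relativeTwist`) matters for the number of faces. Here δ is the coboundary,
and ε (`offset`) corrects for reference rotations that need not be consistently oriented.

Faces are counted by linear algebra. The Z₂-labellings of flags that are constant on faces number
2^|F|. Each of them is, in a unique way, w(v) + y(plane face at the corner), where y vanishes on the
outer face. Constancy along the edges becomes δw = μ · Ny, where N is the edge-face matrix and
(Ny)(e) adds the labels of the two plane faces at e. By plane duality the coboundaries are exactly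
the kernel of Nᵀ. Hence w exists if and only if A_μ y = 0 with A_μ = Nᵀ diag(μ) N (`faceForm`), and
then there are two choices of w. So |F| = |I| + 1 - rank A_μ (`card_face`), and Euler's formula for
the plane embedding turns this into: Euler genus = rank A_μ (`hasEulerGenus_iff`).

If λ vanishes on the spanning tree T, then μ + ε determines S on T up to a global constant, and λ is
then determined as well. So (S, λ) ↦ μ is two-to-one onto all edge labellings
(`IsTree.card_switching`). This gives the factor 2 and the independence of T.

An off-diagonal entry of A_μ is the value of μ on the edge shared by two faces, and a diagonal entry
is the sum of μ around a face. If each edge has two different faces, no two edges have the same pair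
of faces, and every inner face has an edge in common with the outer face, then that edge makes the
diagonal entry free. In this case μ ↦ A_μ is a bijection onto the symmetric matrices supported on
adjacent pairs of faces (`card_faceForm`). For H the inner faces are k large faces and m_i small
faces in the i-th block, and their adjacency (`faceAdj_iff`) is precisely the pattern of Δ. -/

/-! ### Coboundaries over Z₂ and switching along a spanning tree -/

namespace SimpleGraph

open Matrix

variable {V : Type*} {G : SimpleGraph V}

open Classical in
/-- The edge-vertex incidence matrix over `ZMod 2`. -/
noncomputable def edgeVertexMatrix (G : SimpleGraph V) : Matrix G.edgeSet V (ZMod 2) :=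
  Matrix.of fun e v => if v ∈ (e : Sym2 V) then 1 else 0

theorem edgeVertexMatrix_mulVec [Fintype V] (S : V → ZMod 2) {a b : V} (h : G.Adj a b) :
    (G.edgeVertexMatrix *ᵥ S) ⟨s(a, b), h⟩ = S a + S b := by
  classical
  simp only [edgeVertexMatrix, mulVec, dotProduct, Matrix.of_apply, Sym2.mem_iff, ite_mul, one_mul,
    zero_mul]
  rw [← Finset.sum_filter]
  have : Finset.univ.filter (fun v => v = a ∨ v = b) = {a, b} := by ext; simp
  rw [this, Finset.sum_pair h.ne]

theorem Connected.eq_of_adj_imp_eq {α : Type*} (hG : G.Connected) {f : V → α}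
    (hf : ∀ a b, G.Adj a b → f a = f b) (a b : V) : f a = f b := by
  obtain ⟨p⟩ := hG.preconnected a b
  induction p with
  | nil => rfl
  | cons h _ ih => exact (hf _ _ h).trans ih

theorem Connected.edgeVertexMatrix_mulVec_eq_zero_iff [Fintype V] (hG : G.Connected)
    (S : V → ZMod 2) : G.edgeVertexMatrix *ᵥ S = 0 ↔ S = 0 ∨ S = 1 := by
  constructor
  · intro h
    obtain ⟨v₀⟩ := hG.nonempty
    have hc : ∀ a b, S a = S b := hG.eq_of_adj_imp_eq fun a b hab => by
      have := congrFun h ⟨s(a, b), hab⟩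
      rw [edgeVertexMatrix_mulVec] at this
      exact CharTwo.add_eq_zero.mp this
    have h01 : ∀ x : ZMod 2, x = 0 ∨ x = 1 := by decide
    rcases h01 (S v₀) with h0 | h0
    · exact Or.inl (funext fun v => (hc v v₀).trans h0)
    · exact Or.inr (funext fun v => (hc v v₀).trans h0)
  · intro h
    funext e
    obtain ⟨e, he⟩ := e
    induction e with | _ a b
    rw [edgeVertexMatrix_mulVec S he]
    rcases h with rfl | rfl
    · simp
    · exact CharTwo.add_self_eq_zero _

theorem Connected.edgeVertexMatrix_fiber [Fintype V] (hG : G.Connected) (S₀ : V → ZMod 2) :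
    Nat.card {S : V → ZMod 2 // G.edgeVertexMatrix *ᵥ S = G.edgeVertexMatrix *ᵥ S₀} = 2 := by
  have hset : {S : V → ZMod 2 | G.edgeVertexMatrix *ᵥ S = G.edgeVertexMatrix *ᵥ S₀} =
      {S₀, S₀ + 1} := by
    ext S
    rw [Set.mem_ofPred_eq, ← sub_eq_zero, ← mulVec_sub, hG.edgeVertexMatrix_mulVec_eq_zero_iff,
      sub_eq_zero, sub_eq_iff_eq_add']
    simp
  have hne : S₀ ≠ S₀ + 1 := fun h => by
    obtain ⟨v⟩ := hG.nonempty
    simpa using congrFun h v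
  have := Set.ncard_pair hne
  rwa [← hset] at this

theorem Connected.rank_edgeVertexMatrix [Fintype V] [Finite G.edgeSet] (hG : G.Connected) :
    G.edgeVertexMatrix.rank + 1 = Fintype.card V := by
  have hk : LinearMap.ker G.edgeVertexMatrix.mulVecLin = Submodule.span (ZMod 2) {1} := by
    ext S
    rw [LinearMap.mem_ker, Matrix.mulVecLin_apply, hG.edgeVertexMatrix_mulVec_eq_zero_iff,
      Submodule.mem_span_singleton]
    constructor
    · rintro (rfl | rfl)
      · exact ⟨0, zero_smul _ _⟩
      · exact ⟨1, one_smul _ _⟩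
    · rintro ⟨c, rfl⟩
      have h01 : ∀ x : ZMod 2, x = 0 ∨ x = 1 := by decide
      rcases h01 c with rfl | rfl
      · exact Or.inl (zero_smul _ _)
      · exact Or.inr (one_smul _ _)
  have hne : (1 : V → ZMod 2) ≠ 0 := fun h => by
    obtain ⟨v⟩ := hG.nonempty
    simpa using congrFun h v
  have := LinearMap.finrank_range_add_finrank_ker G.edgeVertexMatrix.mulVecLin
  rw [hk, finrank_span_singleton hne, Module.finrank_fintype_fun_eq_card] at this
  exact this

/-- The rank |V| - 1 is the number of edges of a tree, so the coboundary map is onto. -/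
theorem IsTree.exists_edgeVertexMatrix_mulVec [Fintype V] {T : SimpleGraph V} (hT : T.IsTree)
    (τ : T.edgeSet → ZMod 2) : ∃ S, T.edgeVertexMatrix *ᵥ S = τ := by
  classical
  have : Fintype T.edgeSet := Fintype.ofFinite _
  have hr := hT.connected.rank_edgeVertexMatrix
  have hc := hT.card_edgeFinset
  rw [edgeFinset_card] at hc
  have htop : LinearMap.range T.edgeVertexMatrix.mulVecLin = ⊤ := by
    apply Submodule.eq_top_of_finrank_eq
    rw [Module.finrank_fintype_fun_eq_card]
    change T.edgeVertexMatrix.rank = _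
    omega
  have := htop ▸ Submodule.mem_top (R := ZMod 2) (x := τ)
  obtain ⟨S, hS⟩ := this
  exact ⟨S, hS⟩

theorem IsTree.edgeVertexMatrix_fiber [Fintype V] {T : SimpleGraph V} (hT : T.IsTree)
    (τ : T.edgeSet → ZMod 2) :
    Nat.card {S : V → ZMod 2 // T.edgeVertexMatrix *ᵥ S = τ} = 2 := by
  obtain ⟨S₀, rfl⟩ := hT.exists_edgeVertexMatrix_mulVec τ
  exact hT.connected.edgeVertexMatrix_fiber S₀

/-- If `T` is a spanning tree of `G`, then every edge labelling is, up to a constant, cohomologous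
to exactly two pairs of a switching set and a labelling that vanishes on `T`. -/
theorem IsTree.card_switching [Fintype V] {T : SimpleGraph V} (hT : T.IsTree) (hTG : T ≤ G)
    (ε : G.edgeSet → ZMod 2) (Q : (G.edgeSet → ZMod 2) → Prop) :
    Nat.card {x : (V → ZMod 2) × (G.edgeSet → ZMod 2) //
      (∀ e : G.edgeSet, (e : Sym2 V) ∈ T.edgeSet → x.2 e = 0) ∧
        Q (x.2 + G.edgeVertexMatrix *ᵥ x.1 + ε)} =
    2 * Nat.card {μ : G.edgeSet → ZMod 2 // Q μ} := by
  classical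
  let ι : T.edgeSet → G.edgeSet := fun e => ⟨e, edgeSet_mono hTG e.2⟩
  have hι : ∀ (S : V → ZMod 2) (e : T.edgeSet),
      (G.edgeVertexMatrix *ᵥ S) (ι e) = (T.edgeVertexMatrix *ᵥ S) e := by
    intro S e
    rfl
  have hcancel : ∀ a b c : G.edgeSet → ZMod 2, a + b + c + b + c = a := by
    intro a b c
    funext e
    have : ∀ a b c : ZMod 2, a + b + c + b + c = a := by decide
    exact this _ _ _
  -- Fibre over μ = λ + δS + ε. Vanishing of λ on T prescribes δS = μ + ε there, and λ is recovered
  -- from μ and S.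
  have e : {x : (V → ZMod 2) × (G.edgeSet → ZMod 2) //
      (∀ e : G.edgeSet, (e : Sym2 V) ∈ T.edgeSet → x.2 e = 0) ∧
        Q (x.2 + G.edgeVertexMatrix *ᵥ x.1 + ε)} ≃
      Σ μ : {μ : G.edgeSet → ZMod 2 // Q μ},
        {S : V → ZMod 2 // T.edgeVertexMatrix *ᵥ S = fun e => μ.1 (ι e) + ε (ι e)} :=
    { toFun := fun x => ⟨⟨x.1.2 + G.edgeVertexMatrix *ᵥ x.1.1 + ε, x.2.2⟩, x.1.1, by
        funext e
        simp only [Pi.add_apply]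
        rw [← hι, x.2.1 (ι e) e.2]
        have : ∀ b c : ZMod 2, b = 0 + b + c + c := by decide
        exact this _ _⟩
      invFun := fun y => ⟨(y.2.1, y.1.1 + G.edgeVertexMatrix *ᵥ y.2.1 + ε), by
        refine ⟨fun e he => ?_, ?_⟩
        · have := congrFun y.2.2 ⟨e, he⟩
          rw [← hι] at this
          simp only [Pi.add_apply]
          change (G.edgeVertexMatrix *ᵥ y.2.1) e = y.1.1 e + ε e at this
          rw [this]
          have : ∀ a c : ZMod 2, a + (a + c) + c = 0 := by decide
          exact this _ _
        · dsimp only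
          have h : y.1.1 + G.edgeVertexMatrix *ᵥ y.2.1 + ε + G.edgeVertexMatrix *ᵥ y.2.1 + ε =
            y.1.1 := hcancel _ _ _
          rw [h]
          exact y.1.2⟩
      left_inv := fun x => Subtype.ext (Prod.ext rfl (hcancel _ _ _))
      right_inv := fun y => by
        obtain ⟨⟨μ, hμ⟩, S, hS⟩ := y
        have h : μ + G.edgeVertexMatrix *ᵥ S + ε + G.edgeVertexMatrix *ᵥ S + ε = μ :=
          hcancel _ _ _
        refine Sigma.ext (Subtype.ext h) ?_
        dsimp only
        congr! 3
        simp only [h] }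
  rw [Nat.card_congr e, Nat.card_sigma]
  simp_rw [hT.edgeVertexMatrix_fiber]
  simp [mul_comm, Nat.card_eq_fintype_card]

end SimpleGraph

/-! ### Exactness and kernels in linear algebra -/

namespace Matrix

/-- Two matrices that form a complex which is exact by dimension count. -/
theorem exists_mulVec_eq_of_transpose_mulVec_eq_zero {K E V I : Type*} [Field K] [Fintype E]
    [Fintype V] [Fintype I] (B : Matrix E V K) (N : Matrix E I K) (hBN : Bᵀ * N = 0)
    (hr : B.rank + N.rank = Fintype.card E) {x : E → K} (hx : Bᵀ *ᵥ x = 0) : ∃ y, N *ᵥ y = x := by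
  classical
  have hle : LinearMap.range N.mulVecLin ≤ LinearMap.ker Bᵀ.mulVecLin := by
    rintro _ ⟨y, rfl⟩
    rw [LinearMap.mem_ker, mulVecLin_apply, mulVecLin_apply, mulVec_mulVec, hBN, zero_mulVec]
  have h := LinearMap.finrank_range_add_finrank_ker Bᵀ.mulVecLin
  rw [Module.finrank_fintype_fun_eq_card] at h
  change Bᵀ.rank + _ = _ at h
  rw [rank_transpose] at h
  have heq := Submodule.eq_of_le_of_finrank_eq hle (by change N.rank = _; omega)
  have : x ∈ LinearMap.range N.mulVecLin := heq ▸ hx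
  exact this

theorem card_ker_mulVec {I : Type*} [Fintype I] (A : Matrix I I (ZMod 2)) :
    Nat.card {y : I → ZMod 2 // A *ᵥ y = 0} * 2 ^ A.rank = 2 ^ Fintype.card I := by
  classical
  have h := LinearMap.finrank_range_add_finrank_ker A.mulVecLin
  rw [Module.finrank_fintype_fun_eq_card] at h
  change A.rank + _ = _ at h
  have hc : Nat.card (LinearMap.ker A.mulVecLin) =
      2 ^ Module.finrank (ZMod 2) (LinearMap.ker A.mulVecLin) := by
    rw [Module.natCard_eq_pow_finrank (K := ZMod 2), Nat.card_zmod]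
  have : Nat.card {y : I → ZMod 2 // A *ᵥ y = 0} = Nat.card (LinearMap.ker A.mulVecLin) := rfl
  rw [this, hc, ← h, ← pow_add, add_comm]

end Matrix

/-! ### Rotations of cubic graphs relative to plane face data -/

open scoped Matrix

/-- The step of the rotation of a trivalent vertex, relative to a reference rotation. -/
def rotationStep (s : ZMod 2) : ZMod 3 := if s = 0 then 1 else 2

/-- The position of the corner at side `s` of an edge end, relative to that edge end; corners are
named after the opposite edge end. -/
def cornerShift (s : ZMod 2) : ZMod 3 := if s = 0 then 2 else 1

/-- A 3-cycle has no fixed point, and the fixed-point-free permutations of `ZMod 3` are the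
translations by 1 and 2. So a rotation at a trivalent vertex is one bit. -/
theorem isCycleOn_univ_zmod_three {α : Type*} (e : ZMod 3 ≃ α) (σ : Equiv.Perm α) :
    σ.IsCycleOn Set.univ ↔ ∃ s, ∀ i, σ (e i) = e (i + rotationStep s) := by
  constructor
  · intro h
    have hfix : ∀ i, σ (e i) ≠ e i := by
      intro i hi
      obtain ⟨n, hn⟩ := h.2 (Set.mem_univ (e i)) (Set.mem_univ (e (i + 1)))
      rw [Equiv.Perm.zpow_apply_eq_self_of_apply_eq_self hi] at hn
      have hne : ∀ i : ZMod 3, i ≠ i + 1 := by decide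
      exact hne i (e.injective hn)
    have key : ∀ τ : Equiv.Perm (ZMod 3), (∀ i, τ i ≠ i) →
        ∃ s, ∀ i, τ i = i + rotationStep s := by decide
    obtain ⟨s, hs⟩ := key ((e.trans σ).trans e.symm) (fun i hi => hfix i (by
      have := congrArg e hi
      simpa using this))
    exact ⟨s, fun i => by rw [← hs i]; simp⟩
  · rintro ⟨s, hs⟩
    refine ⟨Set.bijOn_univ.mpr σ.bijective, fun x _ y _ => ?_⟩
    obtain ⟨i, rfl⟩ := e.surjective x
    obtain ⟨j, rfl⟩ := e.surjective y
    have key : ∀ (s : ZMod 2) (i j : ZMod 3), j = i ∨ j = i + rotationStep s ∨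
        j = i + rotationStep s + rotationStep s := by decide
    rcases key s i j with h | h | h
    · exact ⟨0, by simp [h]⟩
    · exact ⟨1, by simp [hs, h]⟩
    · exact ⟨2, by
        rw [show (2 : ℤ) = 1 + 1 from rfl, zpow_add, zpow_one, Equiv.Perm.mul_apply, hs, hs, h]⟩

/-- A candidate for the faces of a cubic graph: `nb v` enumerates the neighbours of `v`, and
`opp v i` is the face at the corner of `v` that is opposite to the neighbour `nb v i`; the outer
face is `none`. -/
structure CubicFaceData {V : Type*} (G : SimpleGraph V) (I : Type*) where
  nb : ∀ v, ZMod 3 ≃ G.neighborSet v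
  opp : V → ZMod 3 → Option I
  sides_eq : ∀ v i w j, (nb v i : V) = w → (nb w j : V) = v →
    s(opp v (i + 1), opp v (i + 2)) = s(opp w (j + 1), opp w (j + 2))
  exists_opp : ∀ a, ∃ v i, opp v i = a

namespace CubicFaceData

variable {V : Type*} {G : SimpleGraph V} {I : Type*} (P : CubicFaceData G I)

/-- The `i`-th dart at `v`. -/
def dart (v : V) (i : ZMod 3) : G.Dart := ⟨(v, P.nb v i), (P.nb v i).2⟩

/-- The `i`-th edge at `v`. -/
def edge (v : V) (i : ZMod 3) : G.edgeSet := ⟨s(v, P.nb v i), (P.nb v i).2⟩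

theorem exists_nb {v w : V} (h : G.Adj v w) : ∃ i, (P.nb v i : V) = w :=
  ⟨(P.nb v).symm ⟨w, h⟩, by simp⟩

theorem exists_dart (d : G.Dart) : ∃ v i, d = P.dart v i := by
  obtain ⟨⟨v, w⟩, h⟩ := d
  change G.Adj v w at h
  obtain ⟨i, rfl⟩ := P.exists_nb (v := v) h
  exact ⟨v, i, rfl⟩

theorem exists_edge (e : G.edgeSet) :
    ∃ v i w j, (P.nb v i : V) = w ∧ (P.nb w j : V) = v ∧ e = P.edge v i ∧ e = P.edge w j := by
  obtain ⟨e, he⟩ := e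
  induction e with | _ v w
  change G.Adj v w at he
  obtain ⟨i, rfl⟩ := P.exists_nb (v := v) he
  obtain ⟨j, hj⟩ := P.exists_nb he.symm
  exact ⟨v, i, _, j, rfl, hj, rfl, Subtype.ext (by simp only [edge, hj]; exact Sym2.eq_swap)⟩

theorem nb_injective {v : V} {i j : ZMod 3} (h : (P.nb v i : V) = P.nb v j) : i = j :=
  (P.nb v).injective (Subtype.ext h)

theorem edge_eq {v w : V} {i j : ZMod 3} (hi : (P.nb v i : V) = w) (hj : (P.nb w j : V) = v) :
    P.edge v i = P.edge w j :=
  Subtype.ext (by simp only [edge, hi, hj]; exact Sym2.eq_swap)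

theorem edge_eq_iff {v w : V} {i j : ZMod 3} : P.edge v i = P.edge w j ↔
    (v = w ∧ i = j) ∨ ((P.nb v i : V) = w ∧ (P.nb w j : V) = v) := by
  constructor
  · intro h
    have := congrArg Subtype.val h
    simp only [edge, Sym2.eq_iff] at this
    rcases this with ⟨rfl, h⟩ | ⟨h, h'⟩
    · exact Or.inl ⟨rfl, P.nb_injective h⟩
    · exact Or.inr ⟨h', h.symm⟩
  · rintro (⟨rfl, rfl⟩ | ⟨h, h'⟩)
    · rfl
    · exact P.edge_eq h h'

theorem exists_edge_fun {α : Type*} (q : V → ZMod 3 → α) (hq : ∀ v i w j, (P.nb v i : V) = w →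
    (P.nb w j : V) = v → q v i = q w j) :
    ∃ h : G.edgeSet → α, ∀ v i, h (P.edge v i) = q v i := by
  choose v i w j _ _ he _ using P.exists_edge
  refine ⟨fun e => q (v e) (i e), fun v' i' => ?_⟩
  rcases P.edge_eq_iff.mp (he (P.edge v' i')) with ⟨h, h'⟩ | ⟨h, h'⟩
  · dsimp only
    rw [← h, ← h']
  · exact (hq _ _ _ _ h h').symm

theorem exists_sides : ∃ sides : G.edgeSet → Sym2 (Option I),
    ∀ v i, sides (P.edge v i) = s(P.opp v (i + 1), P.opp v (i + 2)) :=
  P.exists_edge_fun _ P.sides_eq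

/-- The two faces at an edge. -/
noncomputable def sides : G.edgeSet → Sym2 (Option I) := P.exists_sides.choose

theorem sides_edge (v : V) (i : ZMod 3) :
    P.sides (P.edge v i) = s(P.opp v (i + 1), P.opp v (i + 2)) :=
  P.exists_sides.choose_spec v i

/-- The two ends of an edge see the same unordered pair of faces, so their corners are matched in
one of two ways. The value 0 means that the sides are exchanged, as along an untwisted band. -/
theorem exists_offset : ∃ ε : G.edgeSet → ZMod 2, ∀ v i w j, (P.nb v i : V) = w →
    (P.nb w j : V) = v → ∀ t, P.opp v (i + cornerShift t) =
      P.opp w (j + cornerShift (t + ε (P.edge v i) + 1)) := by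
  have key : ∀ e : G.edgeSet, ∃ x : ZMod 2, ∀ v i w j, (P.nb v i : V) = w → (P.nb w j : V) = v →
      e = P.edge v i → ∀ t, P.opp v (i + cornerShift t) = P.opp w (j + cornerShift (t + x + 1)) := by
    intro e
    obtain ⟨v, i, w, j, hi, hj, he, -⟩ := P.exists_edge e
    have h01 : ∀ t : ZMod 2, t = 0 ∨ t = 1 := by decide
    have hx : ∃ x : ZMod 2, ∀ t, P.opp v (i + cornerShift t) =
        P.opp w (j + cornerShift (t + x + 1)) := by
      rcases Sym2.eq_iff.mp (P.sides_eq v i w j hi hj) with ⟨h1, h2⟩ | ⟨h1, h2⟩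
      · refine ⟨1, fun t => ?_⟩
        rcases h01 t with rfl | rfl
        · exact h2
        · exact h1
      · refine ⟨0, fun t => ?_⟩
        rcases h01 t with rfl | rfl
        · exact h2
        · exact h1
    obtain ⟨x, hx⟩ := hx
    refine ⟨x, fun v' i' w' j' hi' hj' he' t => ?_⟩
    rcases P.edge_eq_iff.mp (he.symm.trans he') with ⟨rfl, rfl⟩ | ⟨h, h'⟩
    · subst hi
      subst hi'
      obtain rfl : j = j' := P.nb_injective (hj.trans hj'.symm)
      exact hx t
    · obtain rfl : w = v' := hi.symm.trans h
      obtain rfl : v = w' := h'.symm.trans hi'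
      obtain rfl : i = j' := P.nb_injective (hi.trans hj'.symm)
      obtain rfl : j = i' := P.nb_injective (hj.trans hi'.symm)
      -- Read from the other end, the matching t ↦ t + x + 1 is the same, because it is an
      -- involution.
      rw [hx]
      congr 3
      have : ∀ t x : ZMod 2, t = t + x + 1 + x + 1 := by decide
      exact this _ _
  choose ε hε using key
  exact ⟨ε, fun v i w j hi hj t => hε _ v i w j hi hj rfl t⟩

/-- The edges at which the faces of the reference rotation cross over. -/
noncomputable def offset : G.edgeSet → ZMod 2 := P.exists_offset.choose

theorem opp_offset {v w : V} {i j : ZMod 3} (hi : (P.nb v i : V) = w) (hj : (P.nb w j : V) = v)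
    (t : ZMod 2) : P.opp v (i + cornerShift t) =
      P.opp w (j + cornerShift (t + P.offset (P.edge v i) + 1)) :=
  P.exists_offset.choose_spec v i w j hi hj t

/-- The rotation system with reversed rotations on `x.1` and twisted edges `x.2`. -/
noncomputable def rotationSystem (x : (V → ZMod 2) × (G.edgeSet → ZMod 2)) :
    GeneralRotationSystem G where
  rot v := (P.nb v).permCongr (Equiv.addRight (rotationStep (x.1 v)))
  rot_cyclic v := (isCycleOn_univ_zmod_three (P.nb v) _).mpr ⟨x.1 v, fun i => by simp⟩
  twist := x.2

theorem rotationSystem_rot (x : (V → ZMod 2) × (G.edgeSet → ZMod 2)) (v : V) (i : ZMod 3) :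
    (P.rotationSystem x).rot v (P.nb v i) = P.nb v (i + rotationStep (x.1 v)) := by
  simp [rotationSystem]

theorem rotationSystem_bijective : Function.Bijective P.rotationSystem := by
  constructor
  · intro x y h
    have ht : x.2 = y.2 := congrArg GeneralRotationSystem.twist h
    refine Prod.ext (funext fun v => ?_) ht
    have h1 := P.rotationSystem_rot x v 0
    rw [h, P.rotationSystem_rot] at h1
    have h2 := (P.nb v).injective h1
    have : ∀ a b : ZMod 2, 0 + rotationStep b = 0 + rotationStep a → a = b := by decide
    exact this _ _ h2
  · intro R
    choose S hS using fun v =>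
      (isCycleOn_univ_zmod_three (P.nb v) (R.rot v)).mp (R.rot_cyclic v)
    refine ⟨(S, R.twist), ?_⟩
    have hrot : (P.rotationSystem (S, R.twist)).rot = R.rot := by
      funext v
      ext1 z
      obtain ⟨i, rfl⟩ := (P.nb v).surjective z
      rw [hS, rotationSystem_rot]
    obtain ⟨r, hr, t⟩ := R
    dsimp only at hrot
    unfold rotationSystem at hrot ⊢
    congr

/-! ### Edge-face incidence and plane duality -/

open Classical in
/-- The edge-face incidence matrix over `ZMod 2`; the outer face is left out. -/
noncomputable def edgeFaceMatrix : Matrix G.edgeSet I (ZMod 2) :=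
  Matrix.of fun e f => Sym2.lift ⟨fun a b => (if a = some f then 1 else 0) +
    (if b = some f then 1 else 0), fun _ _ => add_comm _ _⟩ (P.sides e)

/-- The form on face labellings obtained by weighting the edges with `μ`. -/
noncomputable def faceForm [Fintype G.edgeSet] (μ : G.edgeSet → ZMod 2) : Matrix I I (ZMod 2) :=
  P.edgeFaceMatrixᵀ * (Matrix.of fun e f => μ e * P.edgeFaceMatrix e f)

theorem faceForm_mulVec [Fintype G.edgeSet] [Fintype I] (μ : G.edgeSet → ZMod 2)
    (y : I → ZMod 2) :
    P.faceForm μ *ᵥ y = P.edgeFaceMatrixᵀ *ᵥ (μ * (P.edgeFaceMatrix *ᵥ y)) := by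
  rw [faceForm, ← Matrix.mulVec_mulVec]
  congr 1
  funext e
  simp only [Matrix.mulVec, dotProduct, Matrix.of_apply, Pi.mul_apply, Finset.mul_sum, mul_assoc]

theorem edgeFaceMatrix_mulVec [Fintype I] (y : I → ZMod 2) (v : V) (i : ZMod 3) :
    (P.edgeFaceMatrix *ᵥ y) (P.edge v i) =
      (P.opp v (i + 1)).elim 0 y + (P.opp v (i + 2)).elim 0 y := by
  classical
  have key : ∀ a : Option I, ∑ f, (if a = some f then 1 else 0) * y f = a.elim 0 y := by
    rintro (_ | f)
    · simp
    · simp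
  simp only [Matrix.mulVec, dotProduct, edgeFaceMatrix, Matrix.of_apply, sides_edge,
    Sym2.lift_mk, add_mul, Finset.sum_add_distrib, key]

theorem edgeVertexMatrix_transpose_mulVec [Fintype G.edgeSet] (h : G.edgeSet → ZMod 2) (v : V) :
    (G.edgeVertexMatrixᵀ *ᵥ h) v = ∑ i, h (P.edge v i) := by
  classical
  simp only [Matrix.mulVec, dotProduct, Matrix.transpose_apply, SimpleGraph.edgeVertexMatrix,
    Matrix.of_apply, ite_mul, one_mul, zero_mul]
  rw [← Finset.sum_filter]
  symm
  refine Finset.sum_bij (fun i _ => P.edge v i) ?_ ?_ ?_ ?_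
  · intro i _
    simp [edge]
  · intro i _ j _ hij
    rcases P.edge_eq_iff.mp hij with h | h
    · exact h.2
    · exact absurd h.1.symm (G.ne_of_adj (P.nb v i).2)
  · intro e he
    obtain ⟨v', i', w', j', -, -, rfl, he'⟩ := P.exists_edge e
    have hv : v = v' ∨ v = P.nb v' i' := by simpa [edge] using he
    rcases hv with rfl | hv
    · exact ⟨i', Finset.mem_univ _, rfl⟩
    · obtain ⟨j, hj⟩ := P.exists_nb (G.symm.symm _ _ (P.nb v' i').2)
      rw [← hv] at hj
      exact ⟨j, Finset.mem_univ _, P.edge_eq hj hv.symm⟩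
  · intro i _
    rfl

/-- Each corner at a vertex borders two of its three edges, so face boundaries have even degree
everywhere. -/
theorem edgeVertexMatrix_transpose_mul [Fintype G.edgeSet] [Fintype I] :
    G.edgeVertexMatrixᵀ * P.edgeFaceMatrix = 0 := by
  classical
  apply Matrix.ext_of_mulVec_single
  intro f
  rw [← Matrix.mulVec_mulVec, Matrix.zero_mulVec]
  funext v
  rw [P.edgeVertexMatrix_transpose_mulVec]
  simp only [edgeFaceMatrix_mulVec]
  have : ∀ u : ZMod 3 → ZMod 2, ∑ i, (u (i + 1) + u (i + 2)) = 0 := by decide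
  exact this fun i => (P.opp v i).elim 0 _

/-- The ends of an edge share a face, so the constants at adjacent vertices agree. By connectivity
there is a single constant, and it is 0 because the outer face occurs at some corner. -/
theorem opp_elim_const_imp_eq_zero (hG : G.Connected) (y : I → ZMod 2) (u : V → ZMod 2)
    (h : ∀ v i, (P.opp v i).elim 0 y = u v) : y = 0 ∧ u = 0 := by
  have hu : ∀ a b, u a = u b := hG.eq_of_adj_imp_eq fun a b hab => by
    obtain ⟨i, hi⟩ := P.exists_nb hab
    obtain ⟨j, hj⟩ := P.exists_nb hab.symm
    have := P.opp_offset hi hj 0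
    rw [← h a, this, h b]
  obtain ⟨v₀, i₀, h₀⟩ := P.exists_opp none
  have hu0 : ∀ v, u v = 0 := fun v => by
    rw [hu v v₀, ← h v₀ i₀, h₀]
    rfl
  refine ⟨funext fun f => ?_, funext hu0⟩
  obtain ⟨v, i, hi⟩ := P.exists_opp (some f)
  have := h v i
  rw [hi, hu0] at this
  exact this

theorem eq_zero_of_edgeFaceMatrix_mulVec [Fintype I] (hG : G.Connected) {y : I → ZMod 2}
    (hy : P.edgeFaceMatrix *ᵥ y = 0) : y = 0 := by
  have key : ∀ u : ZMod 3 → ZMod 2, (∀ i, u (i + 1) + u (i + 2) = 0) → ∀ i, u i = u 0 := by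
    decide
  refine (P.opp_elim_const_imp_eq_zero hG y (fun v => (P.opp v 0).elim 0 y) fun v i => ?_).1
  refine key (fun i => (P.opp v i).elim 0 y) (fun i => ?_) i
  rw [← edgeFaceMatrix_mulVec, hy]
  rfl

theorem rank_edgeFaceMatrix [Fintype I] [Finite G.edgeSet] (hG : G.Connected) :
    P.edgeFaceMatrix.rank = Fintype.card I := by
  have h := LinearMap.finrank_range_add_finrank_ker P.edgeFaceMatrix.mulVecLin
  have hk : LinearMap.ker P.edgeFaceMatrix.mulVecLin = ⊥ :=
    LinearMap.ker_eq_bot'.mpr fun y hy => P.eq_zero_of_edgeFaceMatrix_mulVec hG hy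
  rw [hk, finrank_bot, Module.finrank_fintype_fun_eq_card] at h
  exact h

/-- Even edge sets are sums of inner face boundaries, by comparing ranks: (|V| - 1) + |I| = |E|. The
hypothesis `hcard` is Euler's formula with the outer face left out. -/
theorem exists_edgeFaceMatrix_mulVec [Fintype V] [Fintype G.edgeSet] [Fintype I] (hG : G.Connected)
    (hcard : Fintype.card V + Fintype.card I = Fintype.card G.edgeSet + 1)
    {h : G.edgeSet → ZMod 2}
    (hh : ∀ v, ∑ i, h (P.edge v i) = 0) : ∃ y, P.edgeFaceMatrix *ᵥ y = h := by
  apply Matrix.exists_mulVec_eq_of_transpose_mulVec_eq_zero G.edgeVertexMatrix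
  · exact P.edgeVertexMatrix_transpose_mul
  · have := hG.rank_edgeVertexMatrix
    rw [P.rank_edgeFaceMatrix hG]
    omega
  · funext v
    rw [P.edgeVertexMatrix_transpose_mulVec]
    exact hh v

/-- The transposed complex is exact by the same count: an edge set meeting every inner face boundary
evenly is a cut. -/
theorem exists_edgeVertexMatrix_mulVec [Fintype V] [Fintype G.edgeSet] [Fintype I] (hG : G.Connected)
    (hcard : Fintype.card V + Fintype.card I = Fintype.card G.edgeSet + 1)
    {h : G.edgeSet → ZMod 2}
    (hh : P.edgeFaceMatrixᵀ *ᵥ h = 0) : ∃ w, G.edgeVertexMatrix *ᵥ w = h := by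
  apply Matrix.exists_mulVec_eq_of_transpose_mulVec_eq_zero P.edgeFaceMatrix
  · rw [← Matrix.transpose_inj]
    simpa using P.edgeVertexMatrix_transpose_mul
  · have := hG.rank_edgeVertexMatrix
    rw [P.rank_edgeFaceMatrix hG]
    omega
  · exact hh

/-- For fixed y, the labelling μ · Ny is a coboundary exactly when the transposed edge-face matrix
kills it, that is when y is in the kernel of the form. The solutions w then form a coset of the
constants. -/
theorem card_coboundary_pairs [Fintype V] [Fintype G.edgeSet] [Fintype I] (hG : G.Connected)
    (hcard : Fintype.card V + Fintype.card I = Fintype.card G.edgeSet + 1)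
    (μ : G.edgeSet → ZMod 2) :
    Nat.card {x : (V → ZMod 2) × (I → ZMod 2) //
      G.edgeVertexMatrix *ᵥ x.1 = μ * (P.edgeFaceMatrix *ᵥ x.2)} =
    2 * Nat.card {y : I → ZMod 2 // P.faceForm μ *ᵥ y = 0} := by
  classical
  have e : {x : (V → ZMod 2) × (I → ZMod 2) //
      G.edgeVertexMatrix *ᵥ x.1 = μ * (P.edgeFaceMatrix *ᵥ x.2)} ≃
      Σ y : {y : I → ZMod 2 // P.faceForm μ *ᵥ y = 0},
        {w : V → ZMod 2 // G.edgeVertexMatrix *ᵥ w = μ * (P.edgeFaceMatrix *ᵥ y.1)} :=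
    { toFun := fun x => ⟨⟨x.1.2, by
        have h := congrArg Matrix.transpose P.edgeVertexMatrix_transpose_mul
        rw [Matrix.transpose_mul, Matrix.transpose_transpose, Matrix.transpose_zero] at h
        rw [faceForm_mulVec, ← x.2, Matrix.mulVec_mulVec, h, Matrix.zero_mulVec]⟩, x.1.1, x.2⟩
      invFun := fun y => ⟨(y.2.1, y.1.1), y.2.2⟩
      left_inv := fun _ => rfl
      right_inv := fun _ => rfl }
  have hfib : ∀ y : {y : I → ZMod 2 // P.faceForm μ *ᵥ y = 0},
      Nat.card {w : V → ZMod 2 // G.edgeVertexMatrix *ᵥ w = μ * (P.edgeFaceMatrix *ᵥ y.1)} = 2 := by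
    rintro ⟨y, hy⟩
    rw [faceForm_mulVec] at hy
    obtain ⟨w, hw⟩ := P.exists_edgeVertexMatrix_mulVec hG hcard hy
    rw [← hw]
    exact hG.edgeVertexMatrix_fiber w
  rw [Nat.card_congr e, Nat.card_sigma]
  simp_rw [hfib]
  simp [mul_comm, Nat.card_eq_fintype_card]

end CubicFaceData

/-! ### Faces of an embedding via invariant labellings of flags -/

theorem GeneralRotationSystem.card_invariants {V : Type*} {G : SimpleGraph V} [Finite G.Dart]
    (R : GeneralRotationSystem G) :
    Nat.card {f : G.Dart × ZMod 2 → ZMod 2 // ∀ a b, R.Step a b → f a = f b} =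
      2 ^ Nat.card R.Face := by
  have : Finite R.Face := Quot.finite _
  have e : (R.Face → ZMod 2) ≃ {f : G.Dart × ZMod 2 → ZMod 2 // ∀ a b, R.Step a b → f a = f b} :=
    { toFun := fun F => ⟨fun a => F (Quot.mk _ a), fun a b h => congrArg F (Quot.sound h)⟩
      invFun := fun f => Quot.lift f.1 f.2
      left_inv := fun F => funext fun a => Quot.inductionOn a fun _ => rfl
      right_inv := fun f => rfl }
  rw [← Nat.card_congr e, Nat.card_fun, Nat.card_zmod]

namespace CubicFaceData

variable {V : Type*} {G : SimpleGraph V} {I : Type*} (P : CubicFaceData G I)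

/-- The twists of the embedding relative to the reference embedding. -/
noncomputable def relativeTwist [Fintype V] (x : (V → ZMod 2) × (G.edgeSet → ZMod 2)) :
    G.edgeSet → ZMod 2 :=
  x.2 + G.edgeVertexMatrix *ᵥ x.1 + P.offset

theorem cornerShift_add (u : ZMod 3 → ZMod 2) (j : ZMod 3) (a b : ZMod 2) :
    u (j + cornerShift a) + u (j + cornerShift b) = (a + b) * (u (j + 1) + u (j + 2)) := by
  revert u j a b
  decide

/-- From a flag at one end, the band leads to a corner at the other end. That corner belongs to the
same plane face if μ(e) = 0. If μ(e) = 1 it is the other corner at the edge, and the labels differ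
by (Ny)(e). The condition is therefore the same for both sides s. -/
theorem coboundary_eq_iff [Fintype V] [Fintype I] (x : (V → ZMod 2) × (G.edgeSet → ZMod 2))
    (w : V → ZMod 2) (y : I → ZMod 2) {a b : V} {i j : ZMod 3} (hi : (P.nb a i : V) = b)
    (hj : (P.nb b j : V) = a) (s : ZMod 2) :
    (G.edgeVertexMatrix *ᵥ w) (P.edge a i) =
        P.relativeTwist x (P.edge a i) * (P.edgeFaceMatrix *ᵥ y) (P.edge a i) ↔
      w a + (P.opp a (i + cornerShift (s + x.1 a))).elim 0 y =
        w b + (P.opp b (j + cornerShift (s + x.2 (P.edge a i) + 1 + x.1 b))).elim 0 y := by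
  subst hi
  rw [relativeTwist, Pi.add_apply, Pi.add_apply, P.opp_offset rfl hj, P.edge_eq rfl hj,
    edgeFaceMatrix_mulVec, ← P.edge_eq rfl hj]
  have h1 : ∀ S : V → ZMod 2,
      (G.edgeVertexMatrix *ᵥ S) (P.edge a i) = S a + S (P.nb a i) :=
    fun S => SimpleGraph.edgeVertexMatrix_mulVec S _
  rw [h1, h1]
  have h2 := cornerShift_add (fun k => (P.opp (P.nb a i) k).elim 0 y) j
    (s + x.1 a + P.offset (P.edge a i) + 1) (s + x.2 (P.edge a i) + 1 + x.1 (P.nb a i))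
  have h3 : s + x.1 a + P.offset (P.edge a i) + 1 + (s + x.2 (P.edge a i) + 1 + x.1 (P.nb a i)) =
      x.2 (P.edge a i) + (x.1 a + x.1 (P.nb a i)) + P.offset (P.edge a i) := by
    have : ∀ s p q r t : ZMod 2, s + p + t + 1 + (s + r + 1 + q) = r + (p + q) + t := by decide
    exact this _ _ _ _ _
  rw [h3] at h2
  rw [← h2]
  have h4 : ∀ p q r t : ZMod 2, p + q = r + t ↔ p + r = q + t := by decide
  exact h4 _ _ _ _

/-- The position of a dart at its initial vertex. -/
def index (d : G.Dart) : ZMod 3 := (P.nb d.fst).symm ⟨d.snd, d.adj⟩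

theorem index_dart (v : V) (i : ZMod 3) : P.index (P.dart v i) = i :=
  (P.nb v).symm_apply_apply i

theorem dart_symm {v w : V} {i j : ZMod 3} (hi : (P.nb v i : V) = w) (hj : (P.nb w j : V) = v) :
    (P.dart v i).symm = P.dart w j := by
  subst hi
  apply SimpleGraph.Dart.ext
  simp [dart, hj]

theorem next_dart (x : (V → ZMod 2) × (G.edgeSet → ZMod 2)) (v : V) (i : ZMod 3) :
    (P.rotationSystem x).next (P.dart v i) = P.dart v (i + rotationStep (x.1 v)) := by
  apply SimpleGraph.Dart.ext
  have := congrArg Subtype.val (P.rotationSystem_rot x v i)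
  exact Prod.ext rfl this

/-- The labelling of flags that belongs to labellings of vertices and faces. -/
def flagLabel (S : V → ZMod 2) (w : V → ZMod 2) (y : I → ZMod 2) (a : G.Dart × ZMod 2) : ZMod 2 :=
  w a.1.fst + (P.opp a.1.fst (P.index a.1 + cornerShift (a.2 + S a.1.fst))).elim 0 y

theorem flagLabel_dart (S : V → ZMod 2) (w : V → ZMod 2) (y : I → ZMod 2) (v : V) (i : ZMod 3)
    (s : ZMod 2) : P.flagLabel S w y (P.dart v i, s) =
      w v + (P.opp v (i + cornerShift (s + S v))).elim 0 y := by
  rw [flagLabel, index_dart]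
  rfl

theorem flagLabel_step [Fintype V] [Fintype I] (x : (V → ZMod 2) × (G.edgeSet → ZMod 2))
    {w : V → ZMod 2} {y : I → ZMod 2}
    (h : G.edgeVertexMatrix *ᵥ w = P.relativeTwist x * (P.edgeFaceMatrix *ᵥ y))
    {a b : G.Dart × ZMod 2} (hab : (P.rotationSystem x).Step a b) :
    P.flagLabel x.1 w y a = P.flagLabel x.1 w y b := by
  cases hab with
  | side d s =>
    obtain ⟨v, i, rfl⟩ := P.exists_dart d
    obtain ⟨j, hj⟩ := P.exists_nb (G.symm.symm _ _ (P.nb v i).2)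
    rw [P.dart_symm rfl hj, flagLabel_dart, flagLabel_dart]
    exact (P.coboundary_eq_iff x w y rfl hj s).mp (congrFun h _)
  | corner d =>
    obtain ⟨v, i, rfl⟩ := P.exists_dart d
    rw [next_dart, flagLabel_dart, flagLabel_dart]
    congr 3
    have : ∀ (i : ZMod 3) (s : ZMod 2), i + cornerShift (0 + s) =
        i + rotationStep s + cornerShift (1 + s) := by decide
    exact this _ _

theorem flagLabel_injective (hG : G.Connected) (S : V → ZMod 2) {w w' : V → ZMod 2}
    {y y' : I → ZMod 2} (h : P.flagLabel S w y = P.flagLabel S w' y') : w = w' ∧ y = y' := by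
  have key : ∀ v k, (P.opp v k).elim 0 (y - y') = (w' - w) v := fun v k => by
    -- This flag faces the corner opposite to k, as `cornerShift 0 = 2`.
    have h1 := congrFun h (P.dart v (k + 1), S v)
    rw [flagLabel_dart, flagLabel_dart] at h1
    have h2 : k + 1 + cornerShift (S v + S v) = k := by
      have : ∀ (k : ZMod 3) (s : ZMod 2), k + 1 + cornerShift (s + s) = k := by decide
      exact this _ _
    rw [h2] at h1
    cases hk : P.opp v k with
    | none =>
      simp only [hk, Option.elim_none, add_zero] at h1
      simp [h1]
    | some f =>
      simp only [hk, Option.elim_some] at h1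
      simp only [Option.elim_some, Pi.sub_apply]
      linear_combination h1
  obtain ⟨h1, h2⟩ := P.opp_elim_const_imp_eq_zero hG _ _ key
  exact ⟨(sub_eq_zero.mp h2).symm, sub_eq_zero.mp h1⟩

/-- Invariance at corners makes f a function g of corners. Invariance along sides makes the sums of
g over the two corners at an edge end an edge labelling. It is even at each vertex, so it comes from
a face labelling y, and the difference between g and y at the corners of v is constant and serves as
w. -/
theorem exists_flagLabel [Fintype V] [Fintype G.edgeSet] [Fintype I] (hG : G.Connected)
    (hcard : Fintype.card V + Fintype.card I = Fintype.card G.edgeSet + 1)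
    (x : (V → ZMod 2) × (G.edgeSet → ZMod 2)) {f : G.Dart × ZMod 2 → ZMod 2}
    (hf : ∀ a b, (P.rotationSystem x).Step a b → f a = f b) :
    ∃ w y, G.edgeVertexMatrix *ᵥ w = P.relativeTwist x * (P.edgeFaceMatrix *ᵥ y) ∧
      P.flagLabel x.1 w y = f := by
  have h01 : ∀ t : ZMod 2, t = 0 ∨ t = 1 := by decide
  obtain ⟨g, hg⟩ : ∃ g : V → ZMod 3 → ZMod 2,
      ∀ v i s, f (P.dart v i, s) = g v (i + cornerShift (s + x.1 v)) := by
    refine ⟨fun v k => f (P.dart v (k + 1), x.1 v), fun v i s => ?_⟩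
    have hc := fun i => hf _ _ (.corner (P.dart v i))
    simp only [next_dart] at hc
    change f (P.dart v i, s) = f (P.dart v (i + cornerShift (s + x.1 v) + 1), x.1 v)
    have h0 : ∀ i : ZMod 3, i + cornerShift 0 + 1 = i := by decide
    have h1 : ∀ i : ZMod 3, i + cornerShift 1 + 1 = i + rotationStep 1 := by decide
    have h2 : ∀ i : ZMod 3, i + rotationStep 1 + rotationStep 0 = i := by decide
    rcases h01 s with rfl | rfl <;> rcases h01 (x.1 v) with h | h <;> rw [h] at hc ⊢
    · rw [add_zero, h0]
    · rw [hc, zero_add, h1]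
    · rw [add_zero, h1, hc, h2]
    · rw [CharTwo.add_self_eq_zero, h0]
  have hside : ∀ v i w j, (P.nb v i : V) = w → (P.nb w j : V) = v → ∀ s,
      g v (i + cornerShift (s + x.1 v)) =
        g w (j + cornerShift (s + x.2 (P.edge v i) + 1 + x.1 w)) := by
    intro v i w j hi hj s
    have := hf _ _ (.side (P.dart v i) s)
    rw [P.dart_symm hi hj, hg, hg] at this
    exact this
  -- The two corners at an edge end are those of its two sides, and the sides lead to the two
  -- corners at the other end. So both ends give the same sum.
  obtain ⟨h, hh⟩ := P.exists_edge_fun (fun v i => g v (i + 1) + g v (i + 2)) (by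
    intro v i w j hi hj
    have h0 := hside v i w j hi hj 0
    have h1 := hside v i w j hi hj 1
    have h2 := cornerShift_add (g v) i (0 + x.1 v) (1 + x.1 v)
    have h3 := cornerShift_add (g w) j (0 + x.2 (P.edge v i) + 1 + x.1 w)
      (1 + x.2 (P.edge v i) + 1 + x.1 w)
    have h4 : ∀ p q : ZMod 2, (0 + p + (1 + p)) = 1 ∧ 0 + p + 1 + q + (1 + p + 1 + q) = 1 := by
      decide
    rw [(h4 _ 0).1, one_mul] at h2
    rw [(h4 _ _).2, one_mul] at h3
    rw [← h2, ← h3, h0, h1])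
  -- Around a vertex every corner is counted twice.
  obtain ⟨y, hy⟩ := P.exists_edgeFaceMatrix_mulVec hG hcard (h := h) (fun v => by
    simp only [hh]
    have : ∀ u : ZMod 3 → ZMod 2, ∑ i, (u (i + 1) + u (i + 2)) = 0 := by decide
    exact this _)
  -- At v, the values of g and the face labels have equal pairwise sums, hence differ by a constant,
  -- here evaluated at the corner 0.
  have hw : ∀ v k, g v k = g v 0 + (P.opp v 0).elim 0 y + (P.opp v k).elim 0 y := by
    intro v
    have key : ∀ u r : ZMod 3 → ZMod 2, (∀ i, r (i + 1) + r (i + 2) = u (i + 1) + u (i + 2)) →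
      ∀ k, u k = u 0 + r 0 + r k := by decide
    refine key (g v) (fun k => (P.opp v k).elim 0 y) (fun i => ?_)
    rw [← edgeFaceMatrix_mulVec, hy, hh]
  refine ⟨fun v => g v 0 + (P.opp v 0).elim 0 y, y, ?_, ?_⟩
  · funext e
    obtain ⟨v, i, w, j, hi, hj, rfl, -⟩ := P.exists_edge e
    refine (P.coboundary_eq_iff x _ y hi hj 0).mpr ?_
    rw [← hw, ← hw]
    exact hside v i w j hi hj 0
  · funext ⟨d, s⟩
    obtain ⟨v, i, rfl⟩ := P.exists_dart d
    rw [flagLabel_dart, ← hw, hg]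

/-- The invariant labellings, 2^|F| in number, are parametrised by the pairs (w, y), which number
twice the kernel of the form. -/
theorem card_face [Fintype V] [Fintype G.edgeSet] [Fintype I] (hG : G.Connected)
    (hcard : Fintype.card V + Fintype.card I = Fintype.card G.edgeSet + 1)
    (x : (V → ZMod 2) × (G.edgeSet → ZMod 2)) :
    Nat.card (P.rotationSystem x).Face + (P.faceForm (P.relativeTwist x)).rank =
      Fintype.card I + 1 := by
  classical
  have : Finite G.Dart := Finite.of_injective (fun d => d.toProd)
    (fun _ _ h => SimpleGraph.Dart.ext _ _ h)
  have hb : Function.Bijective (fun z : {z : (V → ZMod 2) × (I → ZMod 2) //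
      G.edgeVertexMatrix *ᵥ z.1 = P.relativeTwist x * (P.edgeFaceMatrix *ᵥ z.2)} =>
      (⟨P.flagLabel x.1 z.1.1 z.1.2, fun _ _ h => P.flagLabel_step x z.2 h⟩ :
        {f : G.Dart × ZMod 2 → ZMod 2 // ∀ a b, (P.rotationSystem x).Step a b → f a = f b})) := by
    constructor
    · intro z z' h
      have := P.flagLabel_injective hG x.1 (congrArg Subtype.val h)
      exact Subtype.ext (Prod.ext this.1 this.2)
    · rintro ⟨f, hf⟩
      obtain ⟨w, y, h, rfl⟩ := P.exists_flagLabel hG hcard x hf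
      exact ⟨⟨(w, y), h⟩, rfl⟩
  have h1 := Nat.card_congr (Equiv.ofBijective _ hb)
  rw [GeneralRotationSystem.card_invariants, P.card_coboundary_pairs hG hcard] at h1
  have h2 := Matrix.card_ker_mulVec (P.faceForm (P.relativeTwist x))
  -- Compare exponents in 2^|F| · 2^rank = 2 · |ker| · 2^rank = 2^(|I| + 1).
  apply Nat.pow_right_injective (le_refl 2)
  dsimp only
  rw [pow_add, ← h1, pow_succ, ← h2]
  ring

theorem hasEulerGenus_iff [Fintype V] [Fintype G.edgeSet] [Fintype I] (hG : G.Connected)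
    (hcard : Fintype.card V + Fintype.card I = Fintype.card G.edgeSet + 1)
    (x : (V → ZMod 2) × (G.edgeSet → ZMod 2)) (i : ℕ) :
    (P.rotationSystem x).HasEulerGenus i ↔ (P.faceForm (P.relativeTwist x)).rank = i := by
  have h := P.card_face hG hcard x
  unfold GeneralRotationSystem.HasEulerGenus GeneralRotationSystem.eulerChar
  rw [Nat.card_eq_fintype_card, Nat.card_eq_fintype_card]
  omega

/-- The embeddings of Euler genus `i` are counted by the weighted face forms of rank `i`. -/
theorem embeddingCount_eq [Fintype V] [Fintype G.edgeSet] [Fintype I] (hG : G.Connected)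
    (hcard : Fintype.card V + Fintype.card I = Fintype.card G.edgeSet + 1)
    {T : SimpleGraph V} (hT : T ≤ G) (hTree : T.IsTree) (i : ℕ) :
    embeddingCount G T i =
      2 * Nat.card {μ : G.edgeSet → ZMod 2 // (P.faceForm μ).rank = i} := by
  rw [← hTree.card_switching hT P.offset, embeddingCount]
  symm
  refine Nat.card_congr ((Equiv.ofBijective _ P.rotationSystem_bijective).subtypeEquiv
    fun x => ?_)
  exact and_congr Iff.rfl (P.hasEulerGenus_iff hG hcard x i).symm

theorem two_mul_card_edgeSet [Finite V] (P : CubicFaceData G I) :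
    2 * Nat.card G.edgeSet = 3 * Nat.card V := by
  classical
  have := Fintype.ofFinite V
  let e : V × ZMod 3 ≃ G.Dart := Equiv.ofBijective (fun x => P.dart x.1 x.2) (by
    constructor
    · rintro ⟨v, i⟩ ⟨w, j⟩ h
      have h1 := congrArg SimpleGraph.Dart.toProd h
      simp only [dart, Prod.mk.injEq] at h1
      obtain ⟨rfl, h2⟩ := h1
      rw [P.nb_injective h2]
    · intro d
      obtain ⟨v, i, rfl⟩ := P.exists_dart d
      exact ⟨(v, i), rfl⟩)
  have h1 := G.dart_card_eq_twice_card_edges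
  rw [← Fintype.card_congr e, Fintype.card_prod, ZMod.card, SimpleGraph.edgeFinset_card] at h1
  rw [Nat.card_eq_fintype_card, Nat.card_eq_fintype_card, mul_comm 3, h1]

/-! ### Weighted face forms as symmetric matrices supported on adjacent faces -/

open Classical in
theorem edgeFaceMatrix_apply {e : G.edgeSet} (he : ¬ (P.sides e).IsDiag) (f : I) :
    P.edgeFaceMatrix e f = if some f ∈ P.sides e then 1 else 0 := by
  simp only [edgeFaceMatrix, Matrix.of_apply]
  rcases hz : P.sides e with ⟨a, b⟩
  have he : a ≠ b := fun h => he (by rw [hz]; exact h)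
  change Sym2.lift _ s(a, b) = if some f ∈ s(a, b) then 1 else 0
  simp only [Sym2.lift_mk, Sym2.mem_iff]
  by_cases h1 : a = some f <;> by_cases h2 : b = some f
  · exact absurd (h1.trans h2.symm) he
  all_goals simp [h1, h2, eq_comm]

open Classical in
theorem faceForm_apply [Fintype G.edgeSet] (hdiag : ∀ e, ¬ (P.sides e).IsDiag)
    (μ : G.edgeSet → ZMod 2) (f g : I) :
    P.faceForm μ f g = ∑ e with some f ∈ P.sides e ∧ some g ∈ P.sides e, μ e := by
  rw [Finset.sum_filter]
  simp only [faceForm, Matrix.mul_apply, Matrix.transpose_apply, Matrix.of_apply,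
    P.edgeFaceMatrix_apply (hdiag _)]
  refine Finset.sum_congr rfl fun e _ => ?_
  by_cases h1 : some f ∈ P.sides e <;> by_cases h2 : some g ∈ P.sides e <;> simp [h1, h2]

theorem faceForm_isSymm [Fintype G.edgeSet] (μ : G.edgeSet → ZMod 2) :
    (P.faceForm μ).IsSymm := by
  ext f g
  simp only [faceForm, Matrix.transpose_apply, Matrix.mul_apply, Matrix.of_apply]
  exact Finset.sum_congr rfl fun e _ => by ring

theorem faceForm_apply_of_sides [Fintype G.edgeSet] (hdiag : ∀ e, ¬ (P.sides e).IsDiag)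
    (hinj : Function.Injective P.sides) (μ : G.edgeSet → ZMod 2) {f g : I} {e : G.edgeSet}
    (he : P.sides e = s(some f, some g)) : P.faceForm μ f g = μ e := by
  classical
  have hfg : some f ≠ some g := fun h => hdiag e (he ▸ h)
  rw [P.faceForm_apply hdiag]
  have : (Finset.univ.filter fun e => some f ∈ P.sides e ∧ some g ∈ P.sides e) = {e} := by
    ext e'
    simp only [Finset.mem_filter, Finset.mem_univ, true_and, Finset.mem_singleton,
      Sym2.mem_and_mem_iff hfg, ← he]
    exact hinj.eq_iff
  rw [this, Finset.sum_singleton]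

theorem faceForm_apply_eq_zero [Fintype G.edgeSet] (hdiag : ∀ e, ¬ (P.sides e).IsDiag)
    (μ : G.edgeSet → ZMod 2) {f g : I} (hfg : f ≠ g) (h : ∀ e, P.sides e ≠ s(some f, some g)) :
    P.faceForm μ f g = 0 := by
  classical
  rw [P.faceForm_apply hdiag]
  apply Finset.sum_eq_zero
  intro e he
  rw [Finset.mem_filter, Sym2.mem_and_mem_iff (by simpa using hfg)] at he
  exact absurd he.2 (h e)

theorem faceForm_add [Fintype G.edgeSet] (μ ν : G.edgeSet → ZMod 2) :
    P.faceForm (μ + ν) = P.faceForm μ + P.faceForm ν := by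
  simp only [faceForm, ← Matrix.mul_add]
  congr 1
  ext e f
  simp [add_mul]

/-- Off-diagonal entries reveal μ on the edges between inner faces. All but one of the edges of a
face that meets the outer face are of this kind, so its diagonal entry reveals the last value. -/
theorem faceForm_injective [Fintype G.edgeSet] (hdiag : ∀ e, ¬ (P.sides e).IsDiag)
    (hinj : Function.Injective P.sides) : Function.Injective P.faceForm := by
  classical
  intro μ ν h
  have hinner : ∀ e, (∃ f g, P.sides e = s(some f, some g)) → μ e = ν e := by
    rintro e ⟨f, g, he⟩
    rw [← P.faceForm_apply_of_sides hdiag hinj μ he, h, P.faceForm_apply_of_sides hdiag hinj ν he]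
  have houter : ∀ e f, P.sides e = s(none, some f) → μ e = ν e := by
    intro e f he
    have h1 := congrFun (congrFun h f) f
    rw [P.faceForm_apply hdiag, P.faceForm_apply hdiag] at h1
    have hmem : e ∈ Finset.univ.filter fun e => some f ∈ P.sides e ∧ some f ∈ P.sides e := by
      simp [he]
    rw [← Finset.add_sum_erase _ _ hmem, ← Finset.add_sum_erase _ _ hmem] at h1
    have h2 : ∀ e' ∈ (Finset.univ.filter fun e =>
        some f ∈ P.sides e ∧ some f ∈ P.sides e).erase e, μ e' = ν e' := by
      intro e' he'
      rw [Finset.mem_erase, Finset.mem_filter] at he'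
      obtain ⟨b, hb⟩ := he'.2.2.1
      cases b with
      | none =>
        refine absurd (hinj ?_) he'.1
        rw [hb, he, Sym2.eq_swap]
      | some g => exact hinner e' ⟨f, g, hb⟩
    rw [Finset.sum_congr rfl h2] at h1
    exact add_right_cancel h1
  funext e
  have hd := hdiag e
  rcases hz : P.sides e with ⟨a, b⟩
  cases a with
  | none =>
    cases b with
    | none => exact absurd (by rw [hz]; rfl) hd
    | some g => exact houter e g hz
  | some f =>
    cases b with
    | none => exact houter e f (hz.trans Sym2.eq_swap)
    | some g => exact hinner e ⟨f, g, hz⟩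

theorem exists_faceForm_eq [Fintype G.edgeSet] (hdiag : ∀ e, ¬ (P.sides e).IsDiag)
    (hinj : Function.Injective P.sides) (hrim : ∀ f, ∃ e, P.sides e = s(none, some f))
    {A : Matrix I I (ZMod 2)} (hA : A.IsSymm)
    (hsupp : ∀ f g, f ≠ g → (∀ e, P.sides e ≠ s(some f, some g)) → A f g = 0) :
    ∃ μ, P.faceForm μ = A := by
  classical
  -- The weights q produce the off-diagonal part of A and ignore the outer edges. The error B is
  -- then diagonal.
  let q : Sym2 (Option I) → ZMod 2 := Sym2.lift ⟨fun a b => a.elim 0 fun f => b.elim 0 fun g => A f g,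
    fun a b => by cases a <;> cases b <;> simp [hA.apply]⟩
  have hq : ∀ f g, q s(some f, some g) = A f g := fun f g => rfl
  let B := A - P.faceForm fun e => q (P.sides e)
  have hB : ∀ f g, f ≠ g → B f g = 0 := by
    intro f g hfg
    simp only [B, Matrix.sub_apply]
    by_cases h : ∀ e, P.sides e ≠ s(some f, some g)
    · rw [hsupp f g hfg h, P.faceForm_apply_eq_zero hdiag _ hfg h, sub_zero]
    · push Not at h
      obtain ⟨e, he⟩ := h
      rw [P.faceForm_apply_of_sides hdiag hinj _ he, he, hq, sub_self]
  -- Weights on the outer edges alone change only the diagonal, and each inner face has one such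
  -- edge to absorb its error.
  let r : Sym2 (Option I) → ZMod 2 := Sym2.lift ⟨fun a b => a.elim (b.elim 0 fun g => B g g)
    fun f => b.elim (B f f) fun g => 0, fun a b => by cases a <;> cases b <;> simp⟩
  have hr : ∀ f g, r s(some f, some g) = 0 := fun f g => rfl
  have hr0 : ∀ f, r s(none, some f) = B f f := fun f => rfl
  refine ⟨(fun e => q (P.sides e)) + fun e => r (P.sides e), ?_⟩
  rw [faceForm_add, add_comm, ← eq_sub_iff_add_eq]
  ext f g
  by_cases hfg : f = g
  · subst hfg
    obtain ⟨e, he⟩ := hrim f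
    change _ = B f f
    rw [P.faceForm_apply hdiag, Finset.sum_eq_single_of_mem e]
    · rw [he, hr0]
    · simp [he]
    · intro e' he' hne
      rw [Finset.mem_filter] at he'
      obtain ⟨b, hb⟩ := he'.2.1
      cases b with
      | none =>
        refine absurd (hinj ?_) hne
        rw [hb, he, Sym2.eq_swap]
      | some g => rw [hb, hr]
  · change _ = B f g
    rw [hB f g hfg]
    by_cases h : ∀ e, P.sides e ≠ s(some f, some g)
    · rw [P.faceForm_apply_eq_zero hdiag _ hfg h]
    · push Not at h
      obtain ⟨e, he⟩ := h
      rw [P.faceForm_apply_of_sides hdiag hinj _ he, he, hr]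

/-- Weighted face forms correspond to the symmetric matrices supported on the pairs of adjacent
faces. -/
theorem card_faceForm [Fintype G.edgeSet] (hdiag : ∀ e, ¬ (P.sides e).IsDiag)
    (hinj : Function.Injective P.sides) (hrim : ∀ f, ∃ e, P.sides e = s(none, some f))
    (Q : Matrix I I (ZMod 2) → Prop) :
    Nat.card {μ // Q (P.faceForm μ)} = Set.ncard {A : Matrix I I (ZMod 2) | (A.IsSymm ∧
      ∀ f g, f ≠ g → (∀ e, P.sides e ≠ s(some f, some g)) → A f g = 0) ∧ Q A} := by
  rw [← Nat.card_coe_set_eq]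
  refine Nat.card_congr (Equiv.ofBijective (fun μ => ⟨P.faceForm μ.1, ⟨P.faceForm_isSymm _,
    fun f g hfg h => P.faceForm_apply_eq_zero hdiag _ hfg h⟩, μ.2⟩) ⟨?_, ?_⟩)
  · intro μ ν h
    exact Subtype.ext (P.faceForm_injective hdiag hinj (congrArg Subtype.val h))
  · rintro ⟨A, ⟨hA, hs⟩, hQ⟩
    obtain ⟨μ, rfl⟩ := P.exists_faceForm_eq hdiag hinj hrim hA hs
    exact ⟨⟨μ, hQ⟩, rfl⟩

end CubicFaceData

/-! ### Vertices and neighbours of caterpillar-Halin graphs -/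

/-- The function on `ZMod 3` with the given three values. -/
def tri {α : Type*} (a b c : α) (i : ZMod 3) : α := (![a, b, c] : Fin 3 → α) i

theorem forall_zmod_three {p : ZMod 3 → Prop} (h0 : p 0) (h1 : p 1) (h2 : p 2) (i : ZMod 3) :
    p i := by
  have : ∀ i : ZMod 3, i = 0 ∨ i = 1 ∨ i = 2 := by decide
  rcases this i with rfl | rfl | rfl
  exacts [h0, h1, h2]

section Tri

variable {α : Type*} (a b c : α)

@[simp] theorem tri_zero : tri a b c 0 = a := rfl
@[simp] theorem tri_one : tri a b c 1 = b := rfl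
@[simp] theorem tri_two : tri a b c 2 = c := rfl
@[simp] theorem tri_one_add_one : tri a b c (1 + 1) = c := rfl
@[simp] theorem tri_one_add_two : tri a b c (1 + 2) = a := rfl
@[simp] theorem tri_two_add_one : tri a b c (2 + 1) = a := rfl
@[simp] theorem tri_two_add_two : tri a b c (2 + 2) = b := rfl

theorem tri_injective {a b c : α} (hab : a ≠ b) (hac : a ≠ c) (hbc : b ≠ c) :
    Function.Injective (tri a b c) := by
  intro i j
  revert i j
  refine forall_zmod_three ?_ ?_ ?_ <;> refine forall_zmod_three ?_ ?_ ?_ <;>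
    simp [hab, hac, hbc, hab.symm, hac.symm, hbc.symm]

end Tri

namespace CaterpillarHalin

variable {ℓ : ℕ} (up : Fin ℓ → Bool)

/-- The leaf `u_j` lies on the upper (`s = true`) or lower (`s = false`) half of the cycle. -/
def OnSide (s : Bool) (j : ℕ) : Prop :=
  j = 0 ∨ j = ℓ + 1 ∨ ∃ i : Fin ℓ, i.val + 1 = j ∧ up i = s

/-- `u_a` and `u_b` are consecutive, in this order, on one half of the cycle. -/
def RimAdj (s : Bool) (a b : ℕ) : Prop :=
  a < b ∧ b ≤ ℓ + 1 ∧ OnSide up s a ∧ OnSide up s b ∧ ∀ t, a < t → t < b → ¬ OnSide up s t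

/-- The next leaf on one half of the cycle. -/
noncomputable def nextLeaf (s : Bool) (a : ℕ) : ℕ := sInf {t | a < t ∧ OnSide up s t}

/-- The previous leaf on one half of the cycle. -/
noncomputable def prevLeaf (s : Bool) (b : ℕ) : ℕ := sSup {t | t < b ∧ OnSide up s t}

variable {up}

theorem rimAdj_nextLeaf {s : Bool} {a : ℕ} (ha : a ≤ ℓ) (h : OnSide up s a) :
    RimAdj up s a (nextLeaf up s a) := by
  have hl : ℓ + 1 ∈ {t | a < t ∧ OnSide up s t} := ⟨by omega, Or.inr (Or.inl rfl)⟩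
  have h1 := Nat.sInf_mem ⟨_, hl⟩
  refine ⟨h1.1, Nat.sInf_le hl, h, h1.2, fun t h2 h3 h4 => ?_⟩
  exact absurd (Nat.sInf_le (⟨h2, h4⟩ : t ∈ {t | a < t ∧ OnSide up s t})) (not_le.mpr h3)

theorem rimAdj_prevLeaf {s : Bool} {b : ℕ} (hb : 0 < b) (hb' : b ≤ ℓ + 1) (h : OnSide up s b) :
    RimAdj up s (prevLeaf up s b) b := by
  have hl : 0 ∈ {t | t < b ∧ OnSide up s t} := ⟨hb, Or.inl rfl⟩
  have hbd : BddAbove {t | t < b ∧ OnSide up s t} := ⟨b, fun t ht => ht.1.le⟩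
  have h1 := Nat.sSup_mem ⟨_, hl⟩ hbd
  refine ⟨h1.1, hb', h1.2, h, fun t h2 h3 h4 => ?_⟩
  exact absurd (le_csSup hbd (⟨h3, h4⟩ : t ∈ {t | t < b ∧ OnSide up s t})) (not_le.mpr h2)

theorem RimAdj.right_unique {s : Bool} {a b b' : ℕ} (h : RimAdj up s a b) (h' : RimAdj up s a b') :
    b = b' := by
  rcases lt_trichotomy b b' with hl | he | hl
  · exact absurd h.2.2.2.1 (h'.2.2.2.2 b h.1 hl)
  · exact he
  · exact absurd h'.2.2.2.1 (h.2.2.2.2 b' h'.1 hl)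

theorem RimAdj.left_unique {s : Bool} {a a' b : ℕ} (h : RimAdj up s a b) (h' : RimAdj up s a' b) :
    a = a' := by
  rcases lt_trichotomy a a' with hl | he | hl
  · exact absurd h'.2.2.1 (h.2.2.2.2 a' hl h'.1)
  · exact he
  · exact absurd h.2.2.1 (h'.2.2.2.2 a hl h.1)

theorem OnSide.side_unique {s s' : Bool} {a : ℕ} (h : OnSide up s a) (h' : OnSide up s' a)
    (h0 : 0 < a) (hl : a < ℓ + 1) : s = s' := by
  rcases h with h | h | ⟨i, hi, rfl⟩
  · omega
  · omega
  rcases h' with h | h | ⟨j, hj, rfl⟩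
  · omega
  · omega
  obtain rfl : i = j := Fin.ext (by omega)
  rfl

/-- This rules out a double edge of the cycle and lets the side of a cycle edge be read off from its
ends. -/
theorem RimAdj.side_unique {s s' : Bool} {a b : ℕ} (hℓ : 0 < ℓ) (h : RimAdj up s a b)
    (h' : RimAdj up s' a b) : s = s' := by
  obtain ⟨h1, h2, h3, h4, h5⟩ := h
  obtain ⟨-, -, h3', h4', h5'⟩ := h'
  rcases Nat.eq_zero_or_pos a with ha | ha
  · rcases h2.lt_or_eq with hb | hb
    · exact h4.side_unique h4' (by omega) hb
    -- Only an edge from u_0 to u_{ℓ+1} has no end that fixes its side. Since u_1 lies on one half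
    -- and interrupts it there, the edge must be on the other half.
    · have h6 := h5 1 (by omega) (by omega)
      have h7 := h5' 1 (by omega) (by omega)
      have h8 : ∀ r, ¬ OnSide up r 1 → up ⟨0, hℓ⟩ ≠ r := fun r hr he =>
        hr (Or.inr (Or.inr ⟨⟨0, hℓ⟩, rfl, he⟩))
      have h9 : ∀ x p q : Bool, x ≠ p → x ≠ q → p = q := by decide
      exact h9 _ _ _ (h8 _ h6) (h8 _ h7)
  · exact h3.side_unique h3' ha (by omega)

theorem onSide_succ (i : Fin ℓ) : OnSide up (up i) (i.val + 1) := Or.inr (Or.inr ⟨i, rfl, rfl⟩)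

theorem onSide_zero (s : Bool) : OnSide up s 0 := Or.inl rfl

theorem onSide_last (s : Bool) : OnSide up s (ℓ + 1) := Or.inr (Or.inl rfl)

theorem adj_inl_inl {i j : Fin ℓ} : (caterpillarHalin up).Adj (.inl i) (.inl j) ↔
    i.val + 1 = j.val ∨ j.val + 1 = i.val := by
  simp only [caterpillarHalin, SimpleGraph.fromRel_adj, ne_eq, Sum.inl.injEq]
  constructor
  · rintro ⟨-, h⟩
    exact h
  · refine fun h => ⟨?_, h⟩
    rintro rfl
    omega

theorem adj_inl_inr {i : Fin ℓ} {j : Fin (ℓ + 2)} :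
    (caterpillarHalin up).Adj (.inl i) (.inr j) ↔
      j.val = i.val + 1 ∨ (i.val = 0 ∧ j.val = 0) ∨ (i.val + 1 = ℓ ∧ j.val = ℓ + 1) := by
  simp [caterpillarHalin, SimpleGraph.fromRel_adj]

theorem adj_inr_inr {j j' : Fin (ℓ + 2)} : (caterpillarHalin up).Adj (.inr j) (.inr j') ↔
    ∃ s, RimAdj up s j j' ∨ RimAdj up s j' j := by
  have key : ∀ (a b : Fin (ℓ + 2)) (s : Bool), RimAdj up s a b ↔
      OnSide up s a ∧ OnSide up s b ∧ a < b ∧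
        ∀ t : Fin (ℓ + 2), a < t → t < b → ¬ OnSide up s t := by
    intro a b s
    constructor
    · rintro ⟨h1, h2, h3, h4, h5⟩
      exact ⟨h3, h4, h1, fun t ht ht' => h5 t ht ht'⟩
    · rintro ⟨h3, h4, h1, h5⟩
      have := b.isLt
      exact ⟨h1, by omega, h3, h4, fun t ht ht' => h5 ⟨t, by omega⟩ ht ht'⟩
  simp only [key, exists_or]
  constructor
  · rintro ⟨-, h⟩
    exact h
  · intro h
    refine ⟨?_, h⟩
    intro he
    obtain rfl : j = j' := Sum.inr_injective he
    rcases h with ⟨s, -, -, h, -⟩ | ⟨s, -, -, h, -⟩ <;> exact lt_irrefl _ h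

/-- The leaf `u_t`. -/
def leaf (ℓ t : ℕ) : Fin ℓ ⊕ Fin (ℓ + 2) := .inr (Fin.ofNat (ℓ + 2) t)

/-- The node `v_t` of the horizontal path. -/
def node (ℓ t : ℕ) : Fin ℓ ⊕ Fin (ℓ + 2) :=
  if h : 0 < t ∧ t ≤ ℓ then .inl ⟨t - 1, by omega⟩ else leaf ℓ t

theorem val_ofNat {t : ℕ} (h : t ≤ ℓ + 1) : (Fin.ofNat (ℓ + 2) t).val = t :=
  Nat.mod_eq_of_lt (by omega)

theorem inr_eq_leaf (j : Fin (ℓ + 2)) : (.inr j : Fin ℓ ⊕ Fin (ℓ + 2)) = leaf ℓ j := by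
  simp [leaf]

theorem inl_eq_node (i : Fin ℓ) : (.inl i : Fin ℓ ⊕ Fin (ℓ + 2)) = node ℓ (i + 1) := by
  have := i.isLt
  rw [node, dif_pos (by omega)]
  rfl

theorem node_zero : node ℓ 0 = leaf ℓ 0 := dif_neg (by omega)

theorem node_last : node ℓ (ℓ + 1) = leaf ℓ (ℓ + 1) := dif_neg (by omega)

theorem leaf_inj {t t' : ℕ} (h : t ≤ ℓ + 1) (h' : t' ≤ ℓ + 1) : leaf ℓ t = leaf ℓ t' ↔ t = t' := by
  rw [leaf, leaf, Sum.inr.injEq, Fin.ext_iff, val_ofNat h, val_ofNat h']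

theorem node_eq_leaf_iff {t t' : ℕ} (h : t ≤ ℓ + 1) (h' : t' ≤ ℓ + 1) :
    node ℓ t = leaf ℓ t' ↔ t = t' ∧ (t = 0 ∨ t = ℓ + 1) := by
  unfold node
  split_ifs with h0
  · simp only [leaf, reduceCtorEq, false_iff]
    omega
  · rw [leaf_inj h h']
    omega

theorem node_inj {t t' : ℕ} (h : t ≤ ℓ + 1) (h' : t' ≤ ℓ + 1) : node ℓ t = node ℓ t' ↔ t = t' := by
  by_cases h0 : 0 < t' ∧ t' ≤ ℓ
  · by_cases h1 : 0 < t ∧ t ≤ ℓ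
    · rw [node, node, dif_pos h0, dif_pos h1, Sum.inl.injEq, Fin.mk.injEq]
      omega
    · rw [node, node, dif_pos h0, dif_neg h1]
      simp only [leaf, reduceCtorEq, false_iff]
      omega
  · have : node ℓ t' = leaf ℓ t' := dif_neg h0
    rw [this, node_eq_leaf_iff h h']
    omega

theorem adj_leaf {s : Bool} {a b : ℕ} (h : RimAdj up s a b) :
    (caterpillarHalin up).Adj (leaf ℓ a) (leaf ℓ b) := by
  have h1 := h.1
  have h2 := h.2.1
  refine adj_inr_inr.mpr ⟨s, Or.inl ?_⟩
  rwa [val_ofNat h2, val_ofNat (by omega)]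

theorem adj_node (hℓ : 0 < ℓ) {t : ℕ} (ht : t ≤ ℓ) :
    (caterpillarHalin up).Adj (node ℓ t) (node ℓ (t + 1)) := by
  rcases Nat.eq_zero_or_pos t with rfl | h0
  · rw [node_zero, node, dif_pos (by omega)]
    refine SimpleGraph.Adj.symm (adj_inl_inr.mpr ?_)
    simp
  · rcases ht.lt_or_eq with h | rfl
    · rw [node, node, dif_pos (by omega), dif_pos (by omega)]
      refine adj_inl_inl.mpr ?_
      simp only
      omega
    · rw [node_last, node, dif_pos (by omega)]
      refine adj_inl_inr.mpr ?_
      exact Or.inr (Or.inr ⟨Nat.sub_add_cancel h0, val_ofNat le_rfl⟩)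

theorem adj_pendant (i : Fin ℓ) : (caterpillarHalin up).Adj (.inl i) (leaf ℓ (i + 1)) :=
  adj_inl_inr.mpr (by rw [val_ofNat (by omega)]; omega)

theorem vertex_cases {p : Fin ℓ ⊕ Fin (ℓ + 2) → Prop} (hn : ∀ i, p (.inl i)) (h0 : p (leaf ℓ 0))
    (hlast : p (leaf ℓ (ℓ + 1))) (hl : ∀ i : Fin ℓ, p (leaf ℓ (i + 1))) (v) : p v := by
  rcases v with i | j
  · exact hn i
  · rw [inr_eq_leaf]
    have := j.isLt
    generalize j.val = t at this
    rcases Nat.eq_zero_or_pos t with rfl | ht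
    · exact h0
    · rcases (show t = ℓ + 1 ∨ t ≤ ℓ by omega) with rfl | ht'
      · exact hlast
      · have := hl ⟨t - 1, by omega⟩
        rwa [Fin.val_mk, Nat.sub_add_cancel ht] at this

variable (up)

/-- A triple of values at every vertex: at the node, the two ends and the other leaves. -/
def vertexTriple {α : Type*} (f : Fin ℓ → ZMod 3 → α) (g h : ZMod 3 → α) (q : Fin ℓ → ZMod 3 → α) :
    Fin ℓ ⊕ Fin (ℓ + 2) → ZMod 3 → α
  | .inl i => f i
  | .inr j => if h0 : j.val = 0 then g else if h1 : j.val = ℓ + 1 then h else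
      q ⟨j.val - 1, by omega⟩

section VertexTriple

variable {α : Type*} (f : Fin ℓ → ZMod 3 → α) (g h : ZMod 3 → α) (q : Fin ℓ → ZMod 3 → α)

@[simp] theorem vertexTriple_inl (i : Fin ℓ) : vertexTriple f g h q (.inl i) = f i := rfl

@[simp] theorem vertexTriple_zero : vertexTriple f g h q (leaf ℓ 0) = g := by
  simp [leaf, vertexTriple]

@[simp] theorem vertexTriple_last : vertexTriple f g h q (leaf ℓ (ℓ + 1)) = h := by
  simp [leaf, vertexTriple]

@[simp] theorem vertexTriple_leaf (i : Fin ℓ) : vertexTriple f g h q (leaf ℓ (i + 1)) = q i := by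
  have h1 : (Fin.ofNat (ℓ + 2) (i.val + 1)).val = i + 1 := val_ofNat (by omega)
  have h2 := i.isLt
  simp only [leaf, vertexTriple]
  rw [dif_neg (by omega), dif_neg (by omega)]
  congr 1
  exact Fin.ext (by simp only [h1]; omega)

end VertexTriple

/-- The three neighbours of a vertex. -/
noncomputable def neighbor : Fin ℓ ⊕ Fin (ℓ + 2) → ZMod 3 → Fin ℓ ⊕ Fin (ℓ + 2) :=
  vertexTriple (fun i => tri (node ℓ i) (node ℓ (i + 2)) (leaf ℓ (i + 1)))
    (tri (node ℓ 1) (leaf ℓ (nextLeaf up true 0)) (leaf ℓ (nextLeaf up false 0)))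
    (tri (node ℓ ℓ) (leaf ℓ (prevLeaf up true (ℓ + 1))) (leaf ℓ (prevLeaf up false (ℓ + 1))))
    (fun i => tri (.inl i) (leaf ℓ (nextLeaf up (up i) (i + 1)))
      (leaf ℓ (prevLeaf up (up i) (i + 1))))

variable {up}

theorem adj_neighbor (hℓ : 0 < ℓ) (v) (i : ZMod 3) :
    (caterpillarHalin up).Adj v (neighbor up v i) := by
  revert v i
  unfold neighbor
  refine vertex_cases (fun i => ?_) ?_ ?_ (fun i => ?_) <;> refine forall_zmod_three ?_ ?_ ?_ <;>
    simp only [vertexTriple_inl, vertexTriple_zero, vertexTriple_last, vertexTriple_leaf, tri_zero,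
      tri_one, tri_two]
  · rw [inl_eq_node]
    exact (adj_node hℓ (by omega)).symm
  · rw [inl_eq_node]
    exact adj_node hℓ (by omega)
  · exact adj_pendant i
  · rw [← node_zero]
    exact adj_node hℓ (by omega)
  · exact adj_leaf (rimAdj_nextLeaf (by omega) (onSide_zero _))
  · exact adj_leaf (rimAdj_nextLeaf (by omega) (onSide_zero _))
  · rw [← node_last]
    exact (adj_node hℓ le_rfl).symm
  · exact (adj_leaf (rimAdj_prevLeaf (by omega) le_rfl (onSide_last _))).symm
  · exact (adj_leaf (rimAdj_prevLeaf (by omega) le_rfl (onSide_last _))).symm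
  · exact (adj_pendant i).symm
  · exact adj_leaf (rimAdj_nextLeaf (by omega) (onSide_succ i))
  · exact (adj_leaf (rimAdj_prevLeaf (by omega) (by omega) (onSide_succ i))).symm

theorem neighbor_injective (hℓ : 0 < ℓ) (v) : Function.Injective (neighbor up v) := by
  revert v
  unfold neighbor
  refine vertex_cases (fun i => ?_) ?_ ?_ (fun i => ?_) <;>
    simp only [vertexTriple_inl, vertexTriple_zero, vertexTriple_last, vertexTriple_leaf]
  · apply tri_injective
    · rw [Ne, node_inj (by omega) (by omega)]
      omega
    · rw [Ne, node_eq_leaf_iff (by omega) (by omega)]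
      omega
    · rw [Ne, node_eq_leaf_iff (by omega) (by omega)]
      omega
  · have h1 : RimAdj up true 0 _ := rimAdj_nextLeaf (by omega) (onSide_zero _)
    have h2 : RimAdj up false 0 _ := rimAdj_nextLeaf (by omega) (onSide_zero _)
    have h3 := h1.2.1
    have h4 := h2.2.1
    apply tri_injective
    · rw [Ne, node_eq_leaf_iff (by omega) h3]
      omega
    · rw [Ne, node_eq_leaf_iff (by omega) h4]
      omega
    · rw [Ne, leaf_inj h3 h4]
      intro h
      rw [h] at h1
      exact absurd (h1.side_unique hℓ h2) (by decide)
  · have h1 : RimAdj up true _ (ℓ + 1) := rimAdj_prevLeaf (by omega) le_rfl (onSide_last _)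
    have h2 : RimAdj up false _ (ℓ + 1) := rimAdj_prevLeaf (by omega) le_rfl (onSide_last _)
    have h3 := h1.1
    have h4 := h2.1
    apply tri_injective
    · rw [Ne, node_eq_leaf_iff (by omega) (by omega)]
      omega
    · rw [Ne, node_eq_leaf_iff (by omega) (by omega)]
      omega
    · rw [Ne, leaf_inj (by omega) (by omega)]
      intro h
      rw [h] at h1
      exact absurd (h1.side_unique hℓ h2) (by decide)
  · have h1 := rimAdj_nextLeaf (by omega) (onSide_succ (up := up) i)
    have h2 := rimAdj_prevLeaf (by omega) (by omega) (onSide_succ (up := up) i)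
    have h3 := h1.1
    have h4 := h2.1
    apply tri_injective
    · simp [leaf]
    · simp [leaf]
    · rw [Ne, leaf_inj h1.2.1 (by omega)]
      omega

theorem exists_neighbor_eq {v w} (h : (caterpillarHalin up).Adj v w) :
    ∃ i, neighbor up v i = w := by
  revert h
  unfold neighbor
  refine vertex_cases (p := fun v => (caterpillarHalin up).Adj v w → ∃ i, vertexTriple _ _ _ _ v i = w)
    (fun i => ?_) ?_ ?_ (fun i => ?_) v <;>
    simp only [vertexTriple_inl, vertexTriple_zero, vertexTriple_last, vertexTriple_leaf] <;>
    rcases w with k | k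
  · rw [adj_inl_inl, inl_eq_node k]
    rintro (h | h)
    · exact ⟨1, by rw [tri_one, ← h]⟩
    · exact ⟨0, by rw [tri_zero, h]⟩
  · rw [adj_inl_inr, inr_eq_leaf k]
    rintro (h | ⟨h, h'⟩ | ⟨h, h'⟩)
    · exact ⟨2, by rw [tri_two, h]⟩
    · exact ⟨0, by rw [tri_zero, h, h', node_zero]⟩
    · refine ⟨1, ?_⟩
      rw [tri_one, h', ← node_last]
      congr 1
      omega
  · intro h
    have h := adj_inl_inr.mp h.symm
    rw [val_ofNat (by omega)] at h
    refine ⟨0, ?_⟩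
    rw [tri_zero, inl_eq_node]
    congr 1
    omega
  · intro h
    obtain ⟨s, h | h⟩ := adj_inr_inr.mp h <;> rw [val_ofNat (by omega)] at h
    · have := h.right_unique (rimAdj_nextLeaf (by omega) (onSide_zero _))
      rw [inr_eq_leaf k, this]
      cases s
      exacts [⟨2, rfl⟩, ⟨1, rfl⟩]
    · exact absurd h.1 (by omega)
  · intro h
    have h := adj_inl_inr.mp h.symm
    rw [val_ofNat (by omega)] at h
    refine ⟨0, ?_⟩
    rw [tri_zero, inl_eq_node]
    congr 1
    omega
  · intro h
    obtain ⟨s, h | h⟩ := adj_inr_inr.mp h <;> rw [val_ofNat (by omega)] at h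
    · exact absurd h.1 (by omega)
    · have := h.left_unique (rimAdj_prevLeaf (by omega) le_rfl (onSide_last _))
      rw [inr_eq_leaf k, this]
      cases s
      exacts [⟨2, rfl⟩, ⟨1, rfl⟩]
  · intro h
    have h := adj_inl_inr.mp h.symm
    rw [val_ofNat (by omega)] at h
    refine ⟨0, ?_⟩
    rw [tri_zero]
    congr 1
    ext
    omega
  · intro h
    obtain ⟨s, h | h⟩ := adj_inr_inr.mp h <;> rw [val_ofNat (by omega)] at h
    · obtain rfl := h.2.2.1.side_unique (onSide_succ i) (by omega) (by omega)
      have := h.right_unique (rimAdj_nextLeaf (by omega) (onSide_succ i))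
      rw [inr_eq_leaf k, this]
      exact ⟨1, rfl⟩
    · obtain rfl := h.2.2.2.1.side_unique (onSide_succ i) (by omega) (by omega)
      have := h.left_unique (rimAdj_prevLeaf (by omega) (by omega) (onSide_succ i))
      rw [inr_eq_leaf k, this]
      exact ⟨2, rfl⟩

/-- The enumeration of the neighbours of a vertex. -/
noncomputable def neighborEquiv (up : Fin ℓ → Bool) (hℓ : 0 < ℓ) (v) :
    ZMod 3 ≃ (caterpillarHalin up).neighborSet v :=
  Equiv.ofBijective (fun i => ⟨neighbor up v i, adj_neighbor hℓ v i⟩)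
    ⟨fun _ _ h => neighbor_injective hℓ v (congrArg Subtype.val h), fun ⟨_, hw⟩ =>
      (exists_neighbor_eq hw).imp fun _ h => Subtype.ext h⟩

end CaterpillarHalin

/-! ### Faces of the plane embedding of a caterpillar-Halin graph -/

namespace CaterpillarHalin

variable {ℓ : ℕ} {up : Fin ℓ → Bool} {I : Type*} (F : ℕ → Bool → I)

/-- The two faces at the `p`-th edge of the horizontal path. -/
def pathPair (p : ℕ) : Sym2 (Option I) := s(some (F p true), some (F p false))

theorem pathPair_eq (p : ℕ) (s : Bool) : s(some (F p s), some (F p !s)) = pathPair F p := by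
  cases s
  · exact Sym2.eq_swap
  · rfl

theorem pathPair_eq' (p : ℕ) (s : Bool) : s(some (F p !s), some (F p s)) = pathPair F p :=
  Sym2.eq_swap.trans (pathPair_eq F p s)

variable (up) in
open Classical in
/-- The two faces at the edge of the cycle from `u_a` to `u_b`. -/
noncomputable def rimPair (a b : ℕ) : Sym2 (Option I) :=
  s(none, some (F a (decide (RimAdj up true a b))))

variable (up) in
/-- The two faces at the edge between two vertices. -/
noncomputable def facePair : Fin ℓ ⊕ Fin (ℓ + 2) → Fin ℓ ⊕ Fin (ℓ + 2) → Sym2 (Option I)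
  | .inl a, .inl b => pathPair F (max a b)
  | .inl a, .inr j => if j.val = a + 1 then s(some (F a (up a)), some (F (a + 1) (up a))) else
      if j.val = 0 then pathPair F 0 else pathPair F ℓ
  | .inr j, .inl a => if j.val = a + 1 then s(some (F a (up a)), some (F (a + 1) (up a))) else
      if j.val = 0 then pathPair F 0 else pathPair F ℓ
  | .inr j, .inr j' => rimPair up F (min j j') (max j j')

theorem facePair_comm (v w) : facePair up F v w = facePair up F w v := by
  rcases v with a | j <;> rcases w with b | j'
  · simp only [facePair, max_comm]
  · rfl
  · rfl
  · simp only [facePair, max_comm, min_comm]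

theorem facePair_node (hℓ : 0 < ℓ) {p : ℕ} (hp : p ≤ ℓ) :
    facePair up F (node ℓ p) (node ℓ (p + 1)) = pathPair F p := by
  rcases Nat.eq_zero_or_pos p with rfl | h0
  · rw [node_zero, node, dif_pos (by omega)]
    simp [leaf, facePair]
  · rcases hp.lt_or_eq with h | rfl
    · rw [node, node, dif_pos (by omega), dif_pos (by omega)]
      simp only [facePair]
      congr 1
      omega
    · rw [node_last, node, dif_pos (by omega)]
      simp only [leaf, facePair]
      rw [val_ofNat le_rfl, if_neg (by omega), if_neg (by omega)]

theorem facePair_pendant (i : Fin ℓ) : facePair up F (.inl i) (leaf ℓ (i + 1)) =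
    s(some (F i (up i)), some (F (i + 1) (up i))) := by
  simp only [leaf, facePair]
  rw [val_ofNat (by omega), if_pos rfl]

theorem facePair_rim (hℓ : 0 < ℓ) {s : Bool} {a b : ℕ} (h : RimAdj up s a b) :
    facePair up F (leaf ℓ a) (leaf ℓ b) = s(none, some (F a s)) := by
  have h1 := h.1
  have h2 := h.2.1
  simp only [leaf, facePair]
  rw [val_ofNat h2, val_ofNat (by omega), min_eq_left h1.le, max_eq_right h1.le]
  unfold rimPair
  congr 4
  cases s
  · simp only [decide_eq_false_iff_not]
    exact fun h' => absurd (h'.side_unique hℓ h) (by decide)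
  · simpa using h

/-- The face at the corner of a vertex that is opposite to one of the neighbours. -/
def oppositeFace (up : Fin ℓ → Bool) : Fin ℓ ⊕ Fin (ℓ + 2) → ZMod 3 → Option I :=
  vertexTriple (fun i => tri (some (F (i + 1) (up i))) (some (F i (up i))) (some (F i !(up i))))
    (tri none (some (F 0 false)) (some (F 0 true)))
    (tri none (some (F ℓ false)) (some (F ℓ true)))
    (fun i => tri none (some (F i (up i))) (some (F (i + 1) (up i))))

variable {F}

/-- By `hF`, the face on one side of the path changes only where a pendant edge points to that side,
and between consecutive leaves of that side there is none. -/
theorem RimAdj.face_eq (hF : ∀ i : Fin ℓ, F i (!(up i)) = F (i + 1) (!(up i))) {s : Bool} {a b t : ℕ}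
    (h : RimAdj up s a b) (hat : a ≤ t) (htb : t < b) : F a s = F t s := by
  induction t, hat using Nat.le_induction with
  | base => rfl
  | succ t hat ih =>
    rw [ih (by omega)]
    have h1 := h.2.2.2.2 (t + 1) (by omega) htb
    have h2 := h.2.1
    have h3 : (!(up ⟨t, by omega⟩)) = s := by
      by_contra hne
      refine h1 (Or.inr (Or.inr ⟨⟨t, by omega⟩, rfl, ?_⟩))
      have : ∀ x s : Bool, ¬(!x) = s → x = s := by decide
      exact this _ _ hne
    have := hF ⟨t, by omega⟩
    rwa [h3] at this

/-- The faces at an edge end are expressed by a symmetric function of the two vertices, so the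
agreement of both ends required by `sides_eq` becomes symmetry. -/
theorem facePair_neighbor (hℓ : 0 < ℓ)
    (hF : ∀ i : Fin ℓ, F i (!(up i)) = F (i + 1) (!(up i))) (v) (i : ZMod 3) :
    s(oppositeFace F up v (i + 1), oppositeFace F up v (i + 2)) =
      facePair up F v (neighbor up v i) := by
  revert v i
  unfold neighbor oppositeFace
  refine vertex_cases (fun i => ?_) ?_ ?_ (fun i => ?_) <;> refine forall_zmod_three ?_ ?_ ?_ <;>
    simp only [vertexTriple_inl, vertexTriple_zero, vertexTriple_last, vertexTriple_leaf, tri_zero,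
      tri_one, tri_two, zero_add, tri_one_add_one, tri_one_add_two, tri_two_add_one,
      tri_two_add_two]
  · rw [inl_eq_node, facePair_comm, facePair_node F hℓ (by omega), pathPair_eq]
  · rw [inl_eq_node, facePair_node F hℓ (by omega), hF, pathPair_eq']
  · rw [facePair_pendant, Sym2.eq_swap]
  · rw [← node_zero, facePair_node F hℓ (by omega), ← pathPair_eq' F 0 true]
    rfl
  · rw [facePair_rim F hℓ (rimAdj_nextLeaf (by omega) (onSide_zero _)), Sym2.eq_swap]
  · rw [facePair_rim F hℓ (rimAdj_nextLeaf (by omega) (onSide_zero _))]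
  · rw [← node_last, facePair_comm, facePair_node F hℓ le_rfl, ← pathPair_eq' F ℓ true]
    rfl
  · have h : RimAdj up true _ (ℓ + 1) := rimAdj_prevLeaf (by omega) le_rfl (onSide_last _)
    rw [facePair_comm, facePair_rim F hℓ h, h.face_eq hF (by have := h.1; omega) (Nat.lt_succ_self ℓ),
      Sym2.eq_swap]
  · have h : RimAdj up false _ (ℓ + 1) := rimAdj_prevLeaf (by omega) le_rfl (onSide_last _)
    rw [facePair_comm, facePair_rim F hℓ h, h.face_eq hF (by have := h.1; omega) (Nat.lt_succ_self ℓ)]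
  · rw [facePair_comm, facePair_pendant]
  · rw [facePair_rim F hℓ (rimAdj_nextLeaf (by omega) (onSide_succ i)), Sym2.eq_swap]
  · have h := rimAdj_prevLeaf (by omega) (by omega) (onSide_succ (up := up) i)
    rw [facePair_comm, facePair_rim F hℓ h, h.face_eq hF (by have := h.1; omega) (Nat.lt_succ_self i)]

/-- The faces of the plane embedding of the caterpillar-Halin graph: `F p s` is the face above
(`s = true`) or below (`s = false`) the `p`-th edge of the horizontal path. -/
noncomputable def faceData (hℓ : 0 < ℓ) (hF : ∀ i : Fin ℓ, F i (!(up i)) = F (i + 1) (!(up i)))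
    (hsurj : ∀ f, ∃ p s, p ≤ ℓ ∧ F p s = f) : CubicFaceData (caterpillarHalin up) I where
  nb := neighborEquiv up hℓ
  opp := oppositeFace F up
  sides_eq v i w j hi hj := by
    change neighbor up v i = w at hi
    change neighbor up w j = v at hj
    rw [facePair_neighbor hℓ hF, facePair_neighbor hℓ hF, hi, hj, facePair_comm]
  exists_opp a := by
    rcases a with _ | f
    · exact ⟨leaf ℓ 0, 0, by simp [oppositeFace]⟩
    · obtain ⟨p, s, hp, rfl⟩ := hsurj f
      rcases hp.lt_or_eq with h | rfl
      · by_cases hs : up ⟨p, h⟩ = s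
        · exact ⟨.inl ⟨p, h⟩, 1, by simp [oppositeFace, hs]⟩
        · refine ⟨.inl ⟨p, h⟩, 2, ?_⟩
          have : s = !(up ⟨p, h⟩) := by
            have : ∀ x s : Bool, ¬x = s → s = !x := by decide
            exact this _ _ hs
          simp [oppositeFace, this]
      · cases s
        · exact ⟨leaf p (p + 1), 1, by simp [oppositeFace]⟩
        · exact ⟨leaf p (p + 1), 2, by simp [oppositeFace]⟩

section Sides

variable (hℓ : 0 < ℓ) (hF : ∀ i : Fin ℓ, F i (!(up i)) = F (i + 1) (!(up i)))
    (hsurj : ∀ f, ∃ p s, p ≤ ℓ ∧ F p s = f)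

theorem sides_faceData_edge (v) (i : ZMod 3) :
    (faceData hℓ hF hsurj).sides ((faceData hℓ hF hsurj).edge v i) =
      s(oppositeFace F up v (i + 1), oppositeFace F up v (i + 2)) :=
  (faceData hℓ hF hsurj).sides_edge v i

theorem exists_sides_eq_path {p : ℕ} (hp : p ≤ ℓ) :
    ∃ e, (faceData hℓ hF hsurj).sides e = s(some (F p true), some (F p false)) := by
  change ∃ e, _ = pathPair F p
  rcases hp.lt_or_eq with h | rfl
  · refine ⟨_, (sides_faceData_edge hℓ hF hsurj (.inl ⟨p, h⟩) 0).trans ?_⟩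
    rw [← pathPair_eq F p (up ⟨p, h⟩)]
    rfl
  · refine ⟨_, (sides_faceData_edge hℓ hF hsurj (leaf p (p + 1)) 0).trans ?_⟩
    rw [← pathPair_eq F p false]
    simp [oppositeFace]

theorem exists_sides_eq_pendant (i : Fin ℓ) : ∃ e, (faceData hℓ hF hsurj).sides e =
    s(some (F i (up i)), some (F (i + 1) (up i))) := by
  refine ⟨_, (sides_faceData_edge hℓ hF hsurj (.inl i) 2).trans ?_⟩
  rw [Sym2.eq_swap]
  rfl

/-- Move left along the path as long as the face stays the same. This ends at a leaf of its side, or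
at u_0, and the cycle edge leaving that leaf to the right borders the face. -/
theorem exists_sides_eq_rim (f : I) : ∃ e, (faceData hℓ hF hsurj).sides e = s(none, some f) := by
  obtain ⟨p, s, hp, rfl⟩ := hsurj f
  induction p with
  | zero =>
    cases s
    · exact ⟨_, (sides_faceData_edge hℓ hF hsurj (leaf ℓ 0) 2).trans (by simp [oppositeFace])⟩
    · exact ⟨_, (sides_faceData_edge hℓ hF hsurj (leaf ℓ 0) 1).trans (by simp [oppositeFace])⟩
  | succ p ih =>
    by_cases hs : up ⟨p, hp⟩ = s
    · refine ⟨_, (sides_faceData_edge hℓ hF hsurj (leaf ℓ (p + 1)) 1).trans ?_⟩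
      have h1 := vertexTriple_leaf (fun i => tri (some (F (i + 1) (up i))) (some (F i (up i)))
        (some (F i !(up i)))) (tri none (some (F 0 false)) (some (F 0 true)))
        (tri none (some (F ℓ false)) (some (F ℓ true)))
        (fun i => tri none (some (F i (up i))) (some (F (i + 1) (up i)))) ⟨p, hp⟩
      unfold oppositeFace
      rw [h1, tri_one_add_one, tri_one_add_two, hs, Sym2.eq_swap]
    · have h1 : (!(up ⟨p, hp⟩)) = s := by
        have : ∀ x s : Bool, ¬x = s → (!x) = s := by decide
        exact this _ _ hs
      have h2 := hF ⟨p, hp⟩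
      rw [h1] at h2
      rw [← h2]
      exact ih (by omega)

end Sides

end CaterpillarHalin

/-! ### Blocks of the horizontal path and the inner faces of H -/

namespace CaterpillarHalin

variable {k : ℕ} (m : Fin k → ℕ)

/-- The sequence `m`, extended by zero. -/
def extend (i : ℕ) : ℕ := if h : i < k then m ⟨i, h⟩ else 0

/-- The edges of the horizontal path are numbered in blocks of length `m_i + 1` (the last edge of
the last block is missing); this is the first number of a block. -/
def start (i : ℕ) : ℕ := ∑ j ∈ Finset.range i, (extend m j + 1)

/-- The block of the `p`-th edge of the horizontal path. -/
def group (p : ℕ) : ℕ := Nat.findGreatest (fun i => start m i ≤ p) p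

theorem extend_of_lt {i : ℕ} (h : i < k) : extend m i = m ⟨i, h⟩ := dif_pos h

theorem start_zero : start m 0 = 0 := rfl

theorem start_succ (i : ℕ) : start m (i + 1) = start m i + (extend m i + 1) :=
  Finset.sum_range_succ _ _

theorem start_mono : Monotone (start m) :=
  monotone_nat_of_le_succ fun i => by rw [start_succ]; omega

/-- It makes the search bound p in the definition of `group` harmless. -/
theorem le_start (i : ℕ) : i ≤ start m i := by
  induction i with
  | zero => exact Nat.zero_le _
  | succ i ih =>
    rw [start_succ]
    omega

theorem group_eq {i l : ℕ} (h : l ≤ extend m i) : group m (start m i + l) = i := by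
  apply le_antisymm
  · by_contra hlt
    push Not at hlt
    have h1 : start m (group m (start m i + l)) ≤ start m i + l :=
      Nat.findGreatest_spec (P := fun i' => start m i' ≤ start m i + l) (Nat.zero_le _)
        (by rw [start_zero]; omega)
    have h2 := start_mono m hlt
    rw [Nat.succ_eq_add_one, start_succ] at h2
    omega
  · exact Nat.le_findGreatest ((le_start m i).trans (Nat.le_add_right _ _)) (Nat.le_add_right _ _)

theorem exists_slot (p : ℕ) : ∃ i l, l ≤ extend m i ∧ p = start m i + l := by
  induction p with
  | zero => exact ⟨0, 0, Nat.zero_le _, rfl⟩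
  | succ p ih =>
    obtain ⟨i, l, hl, rfl⟩ := ih
    rcases hl.lt_or_eq with h | rfl
    · exact ⟨i, l + 1, h, rfl⟩
    · exact ⟨i + 1, 0, Nat.zero_le _, by rw [start_succ]; omega⟩

theorem lt_of_start_add_lt {i l : ℕ} (h : start m i + l < start m k) : i < k := by
  by_contra hlt
  have := start_mono m (not_lt.mp hlt)
  omega

theorem start_add_lt {i l : ℕ} (hi : i < k) (hl : l ≤ extend m i) :
    start m i + l < start m k := by
  have := start_mono m (Nat.succ_le_of_lt hi)
  rw [Nat.succ_eq_add_one, start_succ] at this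
  omega

theorem start_card : start m k = k + ∑ i, m i := by
  rw [start, Finset.sum_add_distrib, Finset.sum_const, Finset.card_range, smul_eq_mul, mul_one,
    add_comm, ← Fin.sum_univ_eq_sum_range]
  congr 1
  exact Finset.sum_congr rfl fun i _ => extend_of_lt m i.isLt

/-- The pendant edge at v_p belongs to the block of the path edge p on its right. The first block
loses v_0, which has no pendant edge, and the last block lacks its last edge, so these two runs have
length m_i instead of m_i + 1. -/
theorem directions_eq (hk : 2 ≤ k) :
    directions m = (List.range' 1 (start m k - 2)).map fun p => decide (Even (group m p)) := by
  let run : ℕ → List Bool := fun i =>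
    List.replicate (if i = 0 ∨ i + 1 = k then extend m i else extend m i + 1) (decide (Even i))
  have h0 : directions m = ((List.range k).map run).flatten := by
    unfold directions
    congr 1
    apply List.ext_getElem
    · simp
    · intro i h1 h2
      have hi : i < k := by simpa using h2
      simp [run, runLength, extend_of_lt m hi]
  have hrep : ∀ a n i, (∀ p, a ≤ p → p < a + n → group m p = i) →
      (List.range' a n).map (fun p => decide (Even (group m p))) =
        List.replicate n (decide (Even i)) := by
    intro a n i h
    rw [List.eq_replicate_iff]
    refine ⟨by simp, fun b hb => ?_⟩
    obtain ⟨p, hp, rfl⟩ := List.mem_map.mp hb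
    rw [List.mem_range'_1] at hp
    rw [h p hp.1 hp.2]
  have hgroup : ∀ i p, start m i ≤ p → p < start m i + (extend m i + 1) → group m p = i := by
    intro i p h1 h2
    obtain ⟨l, rfl⟩ := Nat.exists_eq_add_of_le h1
    exact group_eq m (by omega)
  have hind : ∀ j, j + 2 ≤ k → ((List.range (j + 1)).map run).flatten =
      (List.range' 1 (start m (j + 1) - 1)).map fun p => decide (Even (group m p)) := by
    intro j
    induction j with
    | zero =>
      intro _
      have h1 : start m 1 = extend m 0 + 1 := by rw [start_succ, start_zero, zero_add]
      rw [zero_add, h1, Nat.add_sub_cancel, hrep 1 _ 0 fun p hp hp' => hgroup 0 p (Nat.zero_le _)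
        (by rw [start_zero]; omega)]
      simp [run]
    | succ j ih =>
      intro hj
      have h1 := le_start m (j + 1)
      rw [List.range_succ, List.map_append, List.flatten_append, ih (by omega)]
      have h2 : start m (j + 1 + 1) - 1 = (start m (j + 1) - 1) + (extend m (j + 1) + 1) := by
        rw [start_succ m (j + 1)]
        omega
      rw [h2, ← List.range'_append_1, List.map_append]
      congr 1
      rw [hrep _ _ (j + 1) fun p hp hp' => hgroup (j + 1) p (by omega) (by omega)]
      have h3 : ¬ (j + 1 = 0 ∨ j + 1 + 1 = k) := by omega
      simp only [run, List.map_cons, List.map_nil, List.flatten_cons, List.flatten_nil,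
        List.append_nil, if_neg h3]
  obtain ⟨j, rfl⟩ : ∃ j, k = j + 2 := ⟨k - 2, by omega⟩
  have h1 := le_start m (j + 1)
  rw [h0, List.range_succ, List.map_append, List.flatten_append, hind j le_rfl]
  have h2 : start m (j + 2) - 2 = (start m (j + 1) - 1) + extend m (j + 1) := by
    rw [start_succ m (j + 1)]
    omega
  rw [h2, ← List.range'_append_1, List.map_append]
  congr 1
  rw [hrep _ _ (j + 1) fun p hp hp' => hgroup (j + 1) p (by omega) (by omega)]
  simp [run]

theorem length_directions (hk : 2 ≤ k) : (directions m).length + 2 = start m k := by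
  have := le_start m k
  rw [directions_eq m hk, List.length_map, List.length_range']
  omega

theorem get_directions (hk : 2 ≤ k) (i : Fin (directions m).length) :
    (directions m).get i = decide (Even (group m (i + 1))) := by
  have : ∀ (L : List Bool) (h : directions m = L) (i : Fin (directions m).length),
      (directions m).get i = L[i.val]'(h ▸ i.isLt) := by
    rintro _ rfl i
    rfl
  rw [this _ (directions_eq m hk)]
  simp [add_comm]

/-- The inner face with a given number: `(i, 0)` is the large face of the `i`-th block, and
`(i, l + 1)` is the `l`-th of its small faces. -/
def faceOf (hk : 2 ≤ k) (i l : ℕ) : Fin k ⊕ Σ i : Fin k, Fin (m i) :=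
  if h : i < k then
    if h' : 0 < l ∧ l - 1 < m ⟨i, h⟩ then .inr ⟨⟨i, h⟩, ⟨l - 1, h'.2⟩⟩ else .inl ⟨i, h⟩
  -- Indices out of range get default values; injectivity is claimed only within range.
  else .inl ⟨0, by omega⟩

variable {m} (hk : 2 ≤ k)

theorem faceOf_zero {i : ℕ} (h : i < k) : faceOf m hk i 0 = .inl ⟨i, h⟩ := by
  rw [faceOf, dif_pos h, dif_neg (by omega)]

theorem faceOf_succ {i l : ℕ} (h : i < k) (hl : l < m ⟨i, h⟩) :
    faceOf m hk i (l + 1) = .inr ⟨⟨i, h⟩, ⟨l, hl⟩⟩ := by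
  rw [faceOf, dif_pos h, dif_pos ⟨by omega, hl⟩]
  rfl

theorem faceOf_injective {i l i' l' : ℕ} (hi : i < k) (hl : l ≤ extend m i) (hi' : i' < k)
    (hl' : l' ≤ extend m i') (h : faceOf m hk i l = faceOf m hk i' l') : i = i' ∧ l = l' := by
  rw [extend_of_lt m hi] at hl
  rw [extend_of_lt m hi'] at hl'
  cases l with
  | zero =>
    cases l' with
    | zero => simpa [faceOf_zero hk hi, faceOf_zero hk hi'] using h
    | succ l' => simp [faceOf_zero hk hi, faceOf_succ hk hi' hl'] at h
  | succ l =>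
    cases l' with
    | zero => simp [faceOf_zero hk hi', faceOf_succ hk hi hl] at h
    | succ l' =>
      rw [faceOf_succ hk hi hl, faceOf_succ hk hi' hl', Sum.inr.injEq, Sigma.mk.injEq,
        Fin.mk.injEq] at h
      obtain ⟨rfl, h⟩ := h
      have := eq_of_heq h
      rw [Fin.mk.injEq] at this
      exact ⟨rfl, by rw [this]⟩

variable (m) in
/-- The face above or below the `p`-th edge of the horizontal path. -/
def pathFace (p : ℕ) (s : Bool) : Fin k ⊕ Σ i : Fin k, Fin (m i) :=
  if s = decide (Even (group m p)) then
    if p - start m (group m p) < extend m (group m p) then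
      faceOf m hk (group m p) (p - start m (group m p) + 1)
    else faceOf m hk (group m p + 1) 0
  else faceOf m hk (group m p) 0

theorem pathFace_outside {i l : ℕ} (hl : l ≤ extend m i) :
    pathFace m hk (start m i + l) (!decide (Even i)) = faceOf m hk i 0 := by
  rw [pathFace, group_eq m hl, if_neg (by simp)]

variable (m) in
/-- The face above or below an edge of the horizontal path that is not the large face of its
block. -/
def insideFace (i l : ℕ) : Fin k ⊕ Σ i : Fin k, Fin (m i) :=
  if l < extend m i then faceOf m hk i (l + 1) else faceOf m hk (i + 1) 0

theorem pathFace_inside {i l : ℕ} (hl : l ≤ extend m i) :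
    pathFace m hk (start m i + l) (decide (Even i)) = insideFace m hk i l := by
  rw [pathFace, group_eq m hl, if_pos rfl, Nat.add_sub_cancel_left]
  rfl

theorem decide_even_succ (i : ℕ) : decide (Even (i + 1)) = !decide (Even i) := by
  rw [← decide_not]
  exact decide_eq_decide.mpr Nat.even_add_one

/-- The face before a pendant edge, on its side. -/
theorem pathFace_pred {i l p : ℕ} (hl : l ≤ extend m i) (hp : p + 1 = start m i + l) :
    pathFace m hk p (decide (Even i)) =
      if l = 0 then faceOf m hk (i - 1) 0 else faceOf m hk i l := by
  split_ifs with h0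
  · subst h0
    cases i with
    | zero => rw [start_zero] at hp; omega
    | succ i =>
      rw [start_succ] at hp
      obtain rfl : p = start m i + extend m i := by omega
      rw [decide_even_succ, pathFace_outside hk le_rfl]
      rfl
  · obtain ⟨l, rfl⟩ := Nat.exists_eq_succ_of_ne_zero h0
    obtain rfl : p = start m i + l := by omega
    rw [pathFace_inside hk (by omega), insideFace, if_pos (by omega)]

/-- The large face of a block starts one edge before the block: if v_{p+1} opens block i, then the
edge p is the last one of block i - 1, and its inside face is the large face of block i. -/
theorem pathFace_opposite {i l p : ℕ} (hl : l ≤ extend m i) (hp : p + 1 = start m i + l) :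
    pathFace m hk p (!decide (Even i)) = faceOf m hk i 0 := by
  rcases Nat.eq_zero_or_pos l with rfl | h0
  · cases i with
    | zero => rw [start_zero] at hp; omega
    | succ i =>
      rw [start_succ] at hp
      obtain rfl : p = start m i + extend m i := by omega
      rw [decide_even_succ, Bool.not_not, pathFace_inside hk le_rfl, insideFace,
        if_neg (lt_irrefl _)]
  · obtain rfl : p = start m i + (l - 1) := by omega
    exact pathFace_outside hk (by omega)

theorem pathFace_step (i : Fin (directions m).length) :
    pathFace m hk i (!(directions m).get i) = pathFace m hk (i + 1) (!(directions m).get i) := by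
  obtain ⟨j, l, hl, hp⟩ := exists_slot m (i.val + 1)
  rw [get_directions m hk, hp, group_eq m hl, pathFace_outside hk hl, pathFace_opposite hk hl hp]

theorem pathFace_surjective (f : Fin k ⊕ Σ i : Fin k, Fin (m i)) :
    ∃ p s, p ≤ (directions m).length ∧ pathFace m hk p s = f := by
  have hlen := length_directions m hk
  rcases f with ⟨i, hi⟩ | ⟨⟨i, hi⟩, ⟨l, hl⟩⟩
  · cases i with
    | zero =>
      refine ⟨start m 0 + 0, !decide (Even 0), Nat.zero_le _, ?_⟩
      rw [pathFace_outside hk (Nat.zero_le _), faceOf_zero hk hi]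
    | succ i =>
      refine ⟨start m i + extend m i, decide (Even i), ?_, ?_⟩
      · have := start_add_lt m hi (Nat.zero_le _)
        rw [start_succ] at this
        omega
      · rw [pathFace_inside hk le_rfl, insideFace, if_neg (lt_irrefl _), faceOf_zero hk hi]
  · rw [← extend_of_lt m hi] at hl
    refine ⟨start m i + l, decide (Even i), ?_, ?_⟩
    · have := start_add_lt m hi (le_refl _)
      omega
    · rw [pathFace_inside hk hl.le, insideFace, if_pos hl, faceOf_succ]

theorem length_directions_pos (hk : 2 ≤ k) (hm : ∀ i : Fin k, i.val + 1 < k → 1 ≤ m i) :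
    0 < (directions m).length := by
  have h1 := length_directions m hk
  have h2 := start_mono m hk
  rw [start_succ, start_succ, start_zero, extend_of_lt m (show 0 < k by omega)] at h2
  have h3 := hm ⟨0, by omega⟩ (by simp only; omega)
  omega

/-- The faces of the plane embedding of `graphH m`. -/
noncomputable def faceDataH (hm : ∀ i : Fin k, i.val + 1 < k → 1 ≤ m i) :
    CubicFaceData (graphH m) (Fin k ⊕ Σ i : Fin k, Fin (m i)) :=
  faceData (length_directions_pos hk hm) (pathFace_step hk) (pathFace_surjective hk)

section Sides

variable (hm : ∀ i : Fin k, i.val + 1 < k → 1 ≤ m i)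

theorem exists_sides_path {i l : ℕ} (hl : l ≤ extend m i) (h : start m i + l + 1 < start m k) :
    ∃ e, (faceDataH hk hm).sides e = s(some (faceOf m hk i 0), some (insideFace m hk i l)) := by
  have hlen := length_directions m hk
  obtain ⟨e, he⟩ := exists_sides_eq_path (length_directions_pos hk hm) (pathFace_step hk)
    (pathFace_surjective hk) (p := start m i + l) (by omega)
  refine ⟨e, he.trans ?_⟩
  rw [← pathFace_inside hk hl, ← pathFace_outside hk hl]
  cases decide (Even i)
  · rfl
  · exact Sym2.eq_swap

theorem exists_sides_pendant {i l : ℕ} (hl : l ≤ extend m i) (h0 : 0 < start m i + l)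
    (h : start m i + l + 1 < start m k) :
    ∃ e, (faceDataH hk hm).sides e =
      s(some (if l = 0 then faceOf m hk (i - 1) 0 else faceOf m hk i l),
        some (insideFace m hk i l)) := by
  have hlen := length_directions m hk
  obtain ⟨p, hp⟩ : ∃ p, p + 1 = start m i + l := ⟨start m i + l - 1, by omega⟩
  obtain ⟨e, he⟩ := exists_sides_eq_pendant (length_directions_pos hk hm) (pathFace_step hk)
    (pathFace_surjective hk) ⟨p, by omega⟩
  refine ⟨e, he.trans ?_⟩
  rw [get_directions m hk]
  dsimp only
  rw [hp, group_eq m hl, pathFace_inside hk hl, pathFace_pred hk hl hp]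

theorem exists_sides_rim (f) : ∃ e, (faceDataH hk hm).sides e = s(none, some f) :=
  exists_sides_eq_rim _ _ _ f

end Sides

end CaterpillarHalin

/-! ### Adjacency of the inner faces of H and the pattern of Δ -/

namespace CaterpillarHalin

variable {k : ℕ} {m : Fin k → ℕ}

/-- The pairs of faces at which the matrices `overlapForm m` have free off-diagonal entries. -/
def FaceAdj : (Fin k ⊕ Σ i : Fin k, Fin (m i)) → (Fin k ⊕ Σ i : Fin k, Fin (m i)) → Prop
  | .inl i, .inl j => i.val + 1 = j.val ∨ j.val + 1 = i.val
  | .inl j, .inr r => j = r.1 ∨ (j.val + 1 = r.1.val ∧ r.2.val = 0) ∨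
      (r.1.val + 1 = j.val ∧ r.2.val + 1 = m r.1)
  | .inr r, .inl j => j = r.1 ∨ (j.val + 1 = r.1.val ∧ r.2.val = 0) ∨
      (r.1.val + 1 = j.val ∧ r.2.val + 1 = m r.1)
  | .inr r, .inr r' => r.1 = r'.1 ∧ (r.2.val + 1 = r'.2.val ∨ r'.2.val + 1 = r.2.val)

theorem FaceAdj.symm {f g : Fin k ⊕ Σ i : Fin k, Fin (m i)} (h : FaceAdj f g) : FaceAdj g f := by
  rcases f with i | r <;> rcases g with j | r'
  · exact Or.symm h
  · exact h
  · exact h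
  · exact ⟨h.1.symm, h.2.symm⟩

theorem tridiag_transpose (n : ℕ) (a : Fin n → ZMod 2) (b : Fin (n - 1) → ZMod 2) :
    (tridiag n a b).transpose = tridiag n a b := by
  ext i j
  simp only [tridiag, Matrix.transpose_apply, Matrix.of_apply]
  by_cases h : i = j
  · subst h
    rfl
  · rw [if_neg h, if_neg (Ne.symm h)]
    by_cases h1 : i.val + 1 = j.val
    · rw [dif_pos h1, dif_neg (by omega), dif_pos h1]
    · by_cases h2 : j.val + 1 = i.val
      · rw [dif_pos h2, dif_neg h1, dif_pos h2]
      · rw [dif_neg h1, dif_neg h2, dif_neg h1]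

theorem tridiag_eq_zero {n : ℕ} (a : Fin n → ZMod 2) (b : Fin (n - 1) → ZMod 2) {i j : Fin n}
    (h : i ≠ j) (h1 : i.val + 1 ≠ j.val) (h2 : j.val + 1 ≠ i.val) : tridiag n a b i j = 0 := by
  simp only [tridiag, Matrix.of_apply]
  rw [if_neg h, dif_neg h1, dif_neg h2]

theorem overlapForm_isSymm (x₀ : Fin k → ZMod 2) (y₀ : Fin (k - 1) → ZMod 2)
    (x : ∀ i : Fin k, Fin (m i) → ZMod 2) (y : ∀ i : Fin k, Fin (m i - 1) → ZMod 2)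
    (z : ∀ i : Fin k, Fin (m i + 2) → ZMod 2) : (overlapForm m x₀ y₀ x y z).IsSymm := by
  unfold overlapForm
  refine Matrix.IsSymm.fromBlocks (tridiag_transpose _ _ _) (Matrix.transpose_transpose _) ?_
  rw [Matrix.IsSymm, Matrix.blockDiagonal'_transpose]
  simp only [tridiag_transpose]

theorem overlapForm_eq_zero (x₀ : Fin k → ZMod 2) (y₀ : Fin (k - 1) → ZMod 2)
    (x : ∀ i : Fin k, Fin (m i) → ZMod 2) (y : ∀ i : Fin k, Fin (m i - 1) → ZMod 2)
    (z : ∀ i : Fin k, Fin (m i + 2) → ZMod 2) {f g : Fin k ⊕ Σ i : Fin k, Fin (m i)} (hfg : f ≠ g)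
    (h : ¬ FaceAdj f g) : overlapForm m x₀ y₀ x y z f g = 0 := by
  have hM : ∀ (r : Σ i : Fin k, Fin (m i)) (j : Fin k), ¬ FaceAdj (.inr r) (.inl j) →
      blockM m z r j = 0 := by
    intro r j h
    simp only [FaceAdj, not_or] at h
    simp only [blockM, Matrix.of_apply]
    rw [if_neg h.1, if_neg h.2.1, if_neg h.2.2]
  rcases f with i | r <;> rcases g with j | r'
  · simp only [FaceAdj, not_or] at h
    exact tridiag_eq_zero _ _ (fun h => hfg (congrArg _ h)) h.1 h.2
  · exact hM r' i fun h' => h h'.symm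
  · exact hM r j h
  · change Matrix.blockDiagonal' (fun i => tridiag (m i) (x i) (y i)) r r' = 0
    obtain ⟨i, l⟩ := r
    obtain ⟨i', l'⟩ := r'
    by_cases hi : i = i'
    · subst hi
      simp only [FaceAdj, true_and, not_or] at h
      rw [Matrix.blockDiagonal'_apply_eq]
      exact tridiag_eq_zero _ _ (fun h => hfg (by rw [h])) h.1 h.2
    · exact Matrix.blockDiagonal'_apply_ne _ _ _ hi

theorem exists_overlapForm_eq (hk : 2 ≤ k)
    {A : Matrix (Fin k ⊕ Σ i : Fin k, Fin (m i)) (Fin k ⊕ Σ i : Fin k, Fin (m i)) (ZMod 2)}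
    (hA : A.IsSymm) (hsupp : ∀ f g, f ≠ g → ¬ FaceAdj f g → A f g = 0) :
    ∃ x₀ y₀ x y z, A = overlapForm m x₀ y₀ x y z := by
  let x₀ : Fin k → ZMod 2 := fun i => A (.inl i) (.inl i)
  let y₀ : Fin (k - 1) → ZMod 2 := fun i => A (.inl ⟨i, by omega⟩) (.inl ⟨i + 1, by omega⟩)
  let x : ∀ i : Fin k, Fin (m i) → ZMod 2 := fun i l => A (.inr ⟨i, l⟩) (.inr ⟨i, l⟩)
  let y : ∀ i : Fin k, Fin (m i - 1) → ZMod 2 := fun i l =>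
    A (.inr ⟨i, ⟨l, by omega⟩⟩) (.inr ⟨i, ⟨l + 1, by omega⟩⟩)
  -- The two extreme entries couple the large face i with the last small face of block i - 1 and
  -- with the first small face of block i + 1. Where no such small face exists the value is a
  -- default that `blockM` never reads.
  let z : ∀ i : Fin k, Fin (m i + 2) → ZMod 2 := fun i t =>
    if t.val = 0 then A (faceOf m hk (i - 1) (extend m (i - 1))) (.inl i)
    else if t.val = m i + 1 then A (faceOf m hk (i + 1) 1) (.inl i)
    else A (faceOf m hk i t) (.inl i)
  have htri : ∀ n (a : Fin n → ZMod 2) (b : Fin (n - 1) → ZMod 2) (B : Matrix (Fin n) (Fin n) (ZMod 2)),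
      B.IsSymm → (∀ i, B i i = a i) → (∀ i : Fin (n - 1), B ⟨i, by omega⟩ ⟨i + 1, by omega⟩ = b i) →
      (∀ i j : Fin n, i ≠ j → ¬ (i.val + 1 = j.val ∨ j.val + 1 = i.val) → B i j = 0) →
      B = tridiag n a b := by
    intro n a b B hB ha hb h0
    ext i j
    simp only [tridiag, Matrix.of_apply]
    split_ifs with h h1 h2
    · rw [h, ha]
    · rw [← hb]
      congr 1
      exact Fin.ext h1.symm
    · rw [← hb, ← hB.apply]
      congr 1
      exact Fin.ext h2.symm
    · exact h0 i j h (by omega)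
  have hM : ∀ (r : Σ i : Fin k, Fin (m i)) (j : Fin k), A (.inr r) (.inl j) = blockM m z r j := by
    rintro ⟨i, l⟩ j
    have hil : faceOf m hk i (l + 1) = .inr ⟨i, l⟩ := faceOf_succ hk i.isLt l.isLt
    simp only [blockM, Matrix.of_apply]
    split_ifs with h h1 h2
    · subst h
      simp only [z]
      rw [if_neg (by omega), if_neg (by omega), hil]
    · simp only [z, Fin.val_last]
      rw [if_neg (by omega), if_true, h1.1, ← hil, h1.2]
    · simp only [z, Fin.val_zero, if_true]
      rw [← h2.1, Nat.add_sub_cancel, extend_of_lt m i.isLt, Fin.eta, ← h2.2, hil]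
    · exact hsupp _ _ (by simp) (by simp only [FaceAdj, not_or]; exact ⟨h, h1, h2⟩)
  refine ⟨x₀, y₀, x, y, z, ?_⟩
  rw [← Matrix.fromBlocks_toBlocks A, overlapForm]
  congr 1
  · refine htri k x₀ y₀ _ (Matrix.IsSymm.ext fun i j => hA.apply _ _) (fun _ => rfl) (fun _ => rfl) ?_
    intro i j h h'
    exact hsupp _ _ (fun h'' => h (Sum.inl_injective h'')) h'
  · ext i r
    rw [Matrix.transpose_apply, ← hM]
    exact hA.apply _ _
  · ext r j
    exact hM r j
  · ext ⟨i, l⟩ ⟨i', l'⟩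
    by_cases hi : i = i'
    · subst hi
      rw [Matrix.blockDiagonal'_apply_eq]
      have := htri (m i) (x i) (y i) (Matrix.of fun l l' => A (.inr ⟨i, l⟩) (.inr ⟨i, l'⟩))
        (Matrix.IsSymm.ext fun l l' => hA.apply _ _) (fun _ => rfl) (fun _ => rfl) (by
          intro l l' h h'
          refine hsupp _ _ (fun h'' => h ?_) (fun h'' => h' h''.2)
          simpa using h'')
      rw [← this]
      rfl
    · rw [Matrix.blockDiagonal'_apply_ne _ _ _ hi]
      exact hsupp _ _ (fun h => hi (congrArg Sigma.fst (Sum.inr_injective h))) (fun h => hi h.1)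

/-- This replaces the parameters by a support condition, the form in which weighted face forms are
described. -/
theorem overlapForm_iff (hk : 2 ≤ k)
    (A : Matrix (Fin k ⊕ Σ i : Fin k, Fin (m i)) (Fin k ⊕ Σ i : Fin k, Fin (m i)) (ZMod 2)) :
    (∃ x₀ y₀ x y z, A = overlapForm m x₀ y₀ x y z) ↔
      A.IsSymm ∧ ∀ f g, f ≠ g → ¬ FaceAdj f g → A f g = 0 := by
  constructor
  · rintro ⟨x₀, y₀, x, y, z, rfl⟩
    exact ⟨overlapForm_isSymm _ _ _ _ _, fun f g => overlapForm_eq_zero _ _ _ _ _⟩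
  · rintro ⟨h1, h2⟩
    exact exists_overlapForm_eq hk h1 h2

variable (hk : 2 ≤ k)

theorem faceAdj_zero_zero {i : ℕ} (h : i + 1 < k) :
    FaceAdj (faceOf m hk i 0) (faceOf m hk (i + 1) 0) := by
  rw [faceOf_zero hk (by omega), faceOf_zero hk h]
  exact Or.inl rfl

theorem faceAdj_zero_succ {i l : ℕ} (h : i < k) (hl : l < extend m i) :
    FaceAdj (faceOf m hk i 0) (faceOf m hk i (l + 1)) := by
  rw [extend_of_lt m h] at hl
  rw [faceOf_zero hk h, faceOf_succ hk h hl]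
  exact Or.inl rfl

theorem faceAdj_pred {i : ℕ} (h : i + 1 < k) (hl : 0 < extend m (i + 1)) :
    FaceAdj (faceOf m hk i 0) (faceOf m hk (i + 1) 1) := by
  rw [extend_of_lt m h] at hl
  rw [faceOf_zero hk (by omega), faceOf_succ hk h hl]
  exact Or.inr (Or.inl ⟨rfl, rfl⟩)

theorem faceAdj_last {i l : ℕ} (h : i + 1 < k) (hl : l + 1 = extend m i) :
    FaceAdj (faceOf m hk i (l + 1)) (faceOf m hk (i + 1) 0) := by
  rw [extend_of_lt m (by omega)] at hl
  rw [faceOf_zero hk h, faceOf_succ hk (by omega) (by omega)]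
  exact Or.inr (Or.inr ⟨rfl, hl⟩)

theorem faceAdj_succ {i l : ℕ} (h : i < k) (hl : l + 1 < extend m i) :
    FaceAdj (faceOf m hk i (l + 1)) (faceOf m hk i (l + 2)) := by
  rw [extend_of_lt m h] at hl
  rw [faceOf_succ hk h (by omega), faceOf_succ hk h (by omega)]
  exact ⟨rfl, Or.inl rfl⟩

theorem sym2_faceOf_eq {a b c d a' b' c' d' : ℕ} (h₁ : a < k ∧ b ≤ extend m a)
    (h₂ : c < k ∧ d ≤ extend m c) (h₃ : a' < k ∧ b' ≤ extend m a') (h₄ : c' < k ∧ d' ≤ extend m c')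
    (h : s(some (faceOf m hk a b), some (faceOf m hk c d)) =
      s(some (faceOf m hk a' b'), some (faceOf m hk c' d'))) :
    (a = a' ∧ b = b') ∧ c = c' ∧ d = d' ∨ (a = c' ∧ b = d') ∧ c = a' ∧ d = b' := by
  rw [Sym2.eq_iff, Option.some_inj, Option.some_inj, Option.some_inj, Option.some_inj] at h
  exact h.imp
    (And.imp (faceOf_injective hk h₁.1 h₁.2 h₃.1 h₃.2) (faceOf_injective hk h₂.1 h₂.2 h₄.1 h₄.2))
    (And.imp (faceOf_injective hk h₁.1 h₁.2 h₄.1 h₄.2) (faceOf_injective hk h₂.1 h₂.2 h₃.1 h₃.2))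

theorem exists_insideFace_eq {i l : ℕ} (hl : l ≤ extend m i)
    (h : start m i + l + 1 < start m k) :
    ∃ c d, insideFace m hk i l = faceOf m hk c d ∧ (c < k ∧ d ≤ extend m c) ∧
      (l < extend m i ∧ c = i ∧ d = l + 1 ∨ l = extend m i ∧ c = i + 1 ∧ d = 0) := by
  have hi : i < k := lt_of_start_add_lt m (l := l) (by omega)
  rcases hl.lt_or_eq with hlt | rfl
  · exact ⟨i, l + 1, if_pos hlt, ⟨hi, hlt⟩, Or.inl ⟨hlt, rfl, rfl⟩⟩
  · refine ⟨i + 1, 0, if_neg (lt_irrefl _), ⟨?_, Nat.zero_le _⟩, Or.inr ⟨rfl, rfl, rfl⟩⟩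
    refine lt_of_start_add_lt m (l := 0) ?_
    rw [start_succ]
    omega

variable (hm : ∀ i : Fin k, i.val + 1 < k → 1 ≤ m i)

theorem exists_path_edge {p : ℕ} (hp : p + 1 < start m k) :
    ∃ i l c d e, l ≤ extend m i ∧ p = start m i + l ∧ i < k ∧ (c < k ∧ d ≤ extend m c) ∧
      (l < extend m i ∧ c = i ∧ d = l + 1 ∨ l = extend m i ∧ c = i + 1 ∧ d = 0) ∧
      (faceDataH hk hm).sides e = s(some (faceOf m hk i 0), some (faceOf m hk c d)) := by
  obtain ⟨i, l, hl, rfl⟩ := exists_slot m p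
  obtain ⟨c, d, h1, h2, h3⟩ := exists_insideFace_eq hk hl hp
  obtain ⟨e, he⟩ := exists_sides_path hk hm hl hp
  exact ⟨i, l, c, d, e, hl, rfl, lt_of_start_add_lt m (l := l) (by omega), h2, h3, h1 ▸ he⟩

include hk hm in
-- A block with m_i = 0 can only be the last one, and its single edge is the missing one. So no
-- pendant edge is both first and last in its block; such an edge would separate two large faces,
-- those of blocks i - 1 and i + 1, which are not adjacent in the pattern.
theorem extend_pos {i l : ℕ} (hl : l ≤ extend m i) (h : start m i + l + 1 < start m k) :
    0 < extend m i := by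
  by_contra h0
  have hi : i < k := lt_of_start_add_lt m (l := l) (by omega)
  rcases (show i + 1 < k ∨ i + 1 = k by omega) with h1 | rfl
  · have := hm ⟨i, hi⟩ h1
    rw [extend_of_lt m hi] at h0
    omega
  · rw [start_succ] at h
    omega

theorem exists_pendant_edge {p : ℕ} (h0 : 0 < p) (hp : p + 1 < start m k) :
    ∃ i l a b c d e, l ≤ extend m i ∧ p = start m i + l ∧ (a < k ∧ b ≤ extend m a) ∧
      (l = 0 ∧ a + 1 = i ∧ b = 0 ∨ 0 < l ∧ a = i ∧ b = l) ∧ (c < k ∧ d ≤ extend m c) ∧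
      (l < extend m i ∧ c = i ∧ d = l + 1 ∨ 0 < l ∧ l = extend m i ∧ c = i + 1 ∧ d = 0) ∧
      (faceDataH hk hm).sides e = s(some (faceOf m hk a b), some (faceOf m hk c d)) := by
  obtain ⟨i, l, hl, rfl⟩ := exists_slot m p
  obtain ⟨c, d, h1, h2, h3⟩ := exists_insideFace_eq hk hl hp
  obtain ⟨e, he⟩ := exists_sides_pendant hk hm hl h0 hp
  have hpos := extend_pos hk hm hl hp
  have hi : i < k := lt_of_start_add_lt m (l := l) (by omega)
  rw [h1] at he
  split_ifs at he with hl0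
  · subst hl0
    have hi0 : i ≠ 0 := by
      rintro rfl
      rw [start_zero] at h0
      omega
    exact ⟨i, 0, i - 1, 0, c, d, e, hl, rfl, ⟨by omega, Nat.zero_le _⟩,
      Or.inl ⟨rfl, by omega, rfl⟩, h2, by omega, he⟩
  · exact ⟨i, l, i, l, c, d, e, hl, rfl, ⟨hi, hl⟩, Or.inr ⟨by omega, rfl, rfl⟩, h2, by omega, he⟩

/-- The faces at the edges of `graphH m`. -/
theorem sides_faceDataH :
    Function.Injective (faceDataH hk hm).sides ∧ ∀ e, (∃ f, (faceDataH hk hm).sides e = s(none, some f)) ∨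
      ∃ f g, FaceAdj f g ∧ f ≠ g ∧ (faceDataH hk hm).sides e = s(some f, some g) := by
  classical
  have hlen := length_directions m hk
  set ℓ := (directions m).length with hℓ
  choose i l c d e hl hp hi hcd hor he using
    fun p : Fin (ℓ + 1) => exists_path_edge hk hm (p := p) (by omega)
  choose i' l' a' b' c' d' e' hl' hp' hab' hor₁ hcd' hor₂ he' using
    fun p : Fin ℓ => exists_pendant_edge hk hm (p := p + 1) (by omega) (by omega)
  choose r hr using exists_sides_rim hk hm
  let E : Fin (ℓ + 1) ⊕ Fin ℓ ⊕ (Fin k ⊕ Σ i : Fin k, Fin (m i)) → (graphH m).edgeSet :=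
    Sum.elim e (Sum.elim e' r)
  -- A path edge borders the large face of a block and either a small face of the same block or the
  -- next large face. A pendant edge separates two small faces of a block, or a small face from the
  -- large face of a neighbouring block.
  have hpath_pend : ∀ p q, (faceDataH hk hm).sides (e p) ≠ (faceDataH hk hm).sides (e' q) := by
    intro p q h
    rw [he, he'] at h
    have h1 := sym2_faceOf_eq hk ⟨hi p, Nat.zero_le _⟩ (hcd p) (hab' q) (hcd' q) h
    have h2 := hor p
    have h3 := hor₁ q
    have h4 := hor₂ q
    omega
  have hinj : Function.Injective fun x => (faceDataH hk hm).sides (E x) := by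
    rintro (p | p | f) (q | q | g) h <;> simp only [E, Sum.elim_inl, Sum.elim_inr] at h
    · rw [he, he] at h
      have h1 := sym2_faceOf_eq hk ⟨hi p, Nat.zero_le _⟩ (hcd p) ⟨hi q, Nat.zero_le _⟩ (hcd q) h
      have h2 := hor p
      have h3 := hor q
      have h4 : i p = i q := by omega
      have h5 := hp p
      have h6 := hp q
      rw [h4] at h2 h5
      exact congrArg _ (Fin.ext (by omega))
    · exact absurd h (hpath_pend p q)
    · rw [he, hr] at h
      simp at h
    · exact absurd h.symm (hpath_pend q p)
    · rw [he', he'] at h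
      have h1 := sym2_faceOf_eq hk (hab' p) (hcd' p) (hab' q) (hcd' q) h
      have h2 := hor₁ p
      have h3 := hor₁ q
      have h2' := hor₂ p
      have h3' := hor₂ q
      have h4 : i' p = i' q := by omega
      have h5 := hp' p
      have h6 := hp' q
      rw [h4] at h2 h2' h5
      exact congrArg _ (congrArg _ (Fin.ext (by omega)))
    · rw [he', hr] at h
      simp at h
    · rw [he, hr] at h
      simp at h
    · rw [he', hr] at h
      simp at h
    · rw [hr, hr] at h
      simp at h
      rw [h]
  have hE : Function.Injective E := fun x y h => hinj (congrArg _ h)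
  -- A cubic graph on 2ℓ + 2 vertices has 3ℓ + 3 edges. As |I| = ℓ + 2, the ℓ + 1 path edges, the ℓ
  -- pendant edges and one cycle edge for each inner face exhaust them.
  have hbij : Function.Bijective E := by
    have : Fintype (graphH m).edgeSet := Fintype.ofFinite _
    rw [Fintype.bijective_iff_injective_and_card]
    refine ⟨hE, ?_⟩
    have h1 := (faceDataH hk hm).two_mul_card_edgeSet
    have h2 := start_card m
    simp only [Nat.card_eq_fintype_card, Fintype.card_sum, Fintype.card_fin, Fintype.card_sigma,
      ← hℓ] at h1 ⊢
    omega
  constructor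
  · intro x y h
    obtain ⟨x, rfl⟩ := hbij.2 x
    obtain ⟨y, rfl⟩ := hbij.2 y
    rw [hinj h]
  · intro x
    obtain ⟨p | p | f, rfl⟩ := hbij.2 x
    · refine Or.inr ⟨_, _, ?_, fun h => ?_, he p⟩
      · have h1 := hi p
        have h2 := (hcd p).1
        rcases hor p with ⟨h3, h4, h5⟩ | ⟨h3, h4, h5⟩ <;> rw [h4, h5]
        · exact faceAdj_zero_succ hk h1 h3
        · exact faceAdj_zero_zero hk (by omega)
      · have := faceOf_injective hk (hi p) (Nat.zero_le _) (hcd p).1 (hcd p).2 h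
        have := hor p
        omega
    · refine Or.inr ⟨_, _, ?_, fun h => ?_, he' p⟩
      · have h1 := (hab' p).1
        have h2 := (hcd' p).1
        rcases hor₁ p with ⟨h3, h4, h5⟩ | ⟨h3, h4, h5⟩ <;>
          rcases hor₂ p with ⟨h6, h7, h8⟩ | ⟨h6, h6', h7, h8⟩ <;> rw [h5, h7, h8]
        · rw [h3, ← h4]
          exact faceAdj_pred hk (by omega) (by rw [h4]; omega)
        · omega
        · rw [h4]
          obtain ⟨n, hn⟩ := Nat.exists_eq_succ_of_ne_zero h3.ne'
          rw [hn] at h6 ⊢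
          exact faceAdj_succ hk (by omega) h6
        · rw [h4]
          obtain ⟨n, hn⟩ := Nat.exists_eq_succ_of_ne_zero h3.ne'
          rw [hn] at h6' ⊢
          exact faceAdj_last hk (by omega) h6'
      · have := faceOf_injective hk (hab' p).1 (hab' p).2 (hcd' p).1 (hcd' p).2 h
        have := hor₁ p
        have := hor₂ p
        omega
    · exact Or.inl ⟨f, hr f⟩

theorem start_add_succ_lt {i l : ℕ} (hi : i < k) (hl : l < extend m i) :
    start m i + l + 1 < start m k :=
  start_add_lt m hi hl

theorem start_last_lt {i : ℕ} (hi : i + 1 < k) : start m i + extend m i + 1 < start m k := by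
  have := start_add_lt m hi (Nat.zero_le _)
  rwa [start_succ] at this

/-- Adjacent faces share an edge. -/
theorem exists_sides_of_faceAdj {f g : Fin k ⊕ Σ i : Fin k, Fin (m i)} (h : FaceAdj f g) :
    ∃ e, (faceDataH hk hm).sides e = s(some f, some g) := by
  have hswap : ∀ f g, (∃ e, (faceDataH hk hm).sides e = s(some f, some g)) →
      ∃ e, (faceDataH hk hm).sides e = s(some g, some f) := fun f g ⟨e, he⟩ =>
    ⟨e, he.trans Sym2.eq_swap⟩
  have hll : ∀ i j : Fin k, i.val + 1 = j.val →
      ∃ e, (faceDataH hk hm).sides e = s(some (.inl i), some (.inl j)) := by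
    rintro ⟨i, hi⟩ ⟨j, hj⟩ hij
    obtain rfl : i + 1 = j := hij
    have := exists_sides_path hk hm (le_refl (extend m i)) (start_last_lt hj)
    rwa [insideFace, if_neg (lt_irrefl _), faceOf_zero hk hi, faceOf_zero hk hj] at this
  have hrr : ∀ (i : Fin k) (l l' : Fin (m i)), l.val + 1 = l'.val →
      ∃ e, (faceDataH hk hm).sides e = s(some (.inr ⟨i, l⟩), some (.inr ⟨i, l'⟩)) := by
    rintro ⟨i, hi⟩ ⟨l, hl⟩ ⟨l', hl'⟩ hll
    obtain rfl : l + 1 = l' := hll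
    have hl2 := hl'
    rw [← extend_of_lt m hi] at hl2
    have := exists_sides_pendant hk hm hl2.le (by omega) (start_add_succ_lt hi hl2)
    rwa [insideFace, if_pos hl2, if_neg (by omega), faceOf_succ hk hi hl,
      faceOf_succ hk hi hl'] at this
  have hrl : ∀ (r : Σ i : Fin k, Fin (m i)) (j : Fin k), FaceAdj (.inr r) (.inl j) →
      ∃ e, (faceDataH hk hm).sides e = s(some (.inl j), some (.inr r)) := by
    rintro ⟨⟨i, hi⟩, ⟨l, hl⟩⟩ ⟨j, hj⟩ h
    have hl2 := hl
    rw [← extend_of_lt m hi] at hl2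
    rcases h with h | ⟨h, h'⟩ | ⟨h, h'⟩
    · obtain rfl : j = i := congrArg Fin.val h
      have := exists_sides_path hk hm hl2.le (start_add_succ_lt hi hl2)
      rwa [insideFace, if_pos hl2, faceOf_zero hk hi, faceOf_succ hk hi hl] at this
    · obtain rfl : j + 1 = i := h
      obtain rfl : l = 0 := h'
      have := exists_sides_pendant hk hm hl2.le (by rw [start_succ]; omega)
        (start_add_succ_lt hi hl2)
      rwa [insideFace, if_pos hl2, if_pos rfl, Nat.add_sub_cancel, faceOf_zero hk hj,
        faceOf_succ hk hi hl] at this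
    · obtain rfl : i + 1 = j := h
      have h1 : l + 1 = extend m i := by rw [extend_of_lt m hi]; exact h'
      have h2 := start_last_lt (m := m) hj
      rw [← h1] at h2
      have := exists_sides_pendant hk hm h1.le (by omega) h2
      rw [insideFace, if_neg (by omega), if_neg (by omega), faceOf_zero hk hj,
        faceOf_succ hk hi hl] at this
      exact hswap _ _ this
  rcases f with i | r <;> rcases g with j | r'
  · rcases h with h | h
    · exact hll i j h
    · exact hswap _ _ (hll j i h)
  · exact hrl r' i h.symm
  · exact hswap _ _ (hrl r j h)
  · obtain ⟨i, l⟩ := r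
    obtain ⟨i', l'⟩ := r'
    obtain ⟨h1, h⟩ := h
    obtain rfl : i = i' := h1
    rcases h with h | h
    · exact hrr i l l' h
    · exact hswap _ _ (hrr i l' l h)

theorem faceAdj_iff {f g : Fin k ⊕ Σ i : Fin k, Fin (m i)} :
    FaceAdj f g ↔ ∃ e, (faceDataH hk hm).sides e = s(some f, some g) := by
  refine ⟨exists_sides_of_faceAdj hk hm, fun ⟨e, he⟩ => ?_⟩
  rcases (sides_faceDataH hk hm).2 e with ⟨f', h⟩ | ⟨f', g', h, -, h'⟩
  · rw [he] at h
    simp at h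
  · rw [he, Sym2.eq_iff, Option.some_inj, Option.some_inj, Option.some_inj, Option.some_inj] at h'
    rcases h' with ⟨rfl, rfl⟩ | ⟨rfl, rfl⟩
    exacts [h, h.symm]

theorem card_faceForm_eq_deltaCount [Fintype (graphH m).edgeSet] (j : ℕ) :
    Nat.card {μ // ((faceDataH hk hm).faceForm μ).rank = j} = deltaCount m j := by
  obtain ⟨hinj, hcases⟩ := sides_faceDataH hk hm
  rw [(faceDataH hk hm).card_faceForm _ hinj (exists_sides_rim hk hm) (fun A => A.rank = j),
    deltaCount]
  · congr 1
    ext A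
    simp only [Set.mem_ofPred_eq, overlapForm_iff hk, faceAdj_iff hk hm, not_exists, ne_eq]
  · intro e
    rcases hcases e with ⟨f, h⟩ | ⟨f, g, -, hne, h⟩ <;> rw [h]
    · simp
    · simpa using hne

end CaterpillarHalin

/-! ### Comparison of the two polynomials -/

theorem mainTheorem6 (k : ℕ) (hk : 2 ≤ k) (m : Fin k → ℕ)
    (hm : ∀ i : Fin k, i.val + 1 < k → 1 ≤ m i)
    (T : SimpleGraph (Fin (directions m).length ⊕ Fin ((directions m).length + 2)))
    (hT : T ≤ graphH m) (hTree : T.IsTree) :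
    eulerGenusPolynomial (graphH m) T = 2 * deltaPolynomial m := by
  classical
  have : Fintype (graphH m).edgeSet := Fintype.ofFinite _
  let P := CaterpillarHalin.faceDataH hk hm
  -- Euler's formula for the plane embedding: |V| = 2ℓ + 2, |E| = 3ℓ + 3 and |I| = ℓ + 2.
  have hcard : Fintype.card (Fin (directions m).length ⊕ Fin ((directions m).length + 2)) +
      Fintype.card (Fin k ⊕ Σ i : Fin k, Fin (m i)) = Fintype.card (graphH m).edgeSet + 1 := by
    have h1 := P.two_mul_card_edgeSet
    have h2 := CaterpillarHalin.start_card m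
    have h3 := CaterpillarHalin.length_directions m hk
    simp only [Nat.card_eq_fintype_card, Fintype.card_sum, Fintype.card_fin,
      Fintype.card_sigma] at h1 ⊢
    omega
  have hcount : ∀ i, embeddingCount (graphH m) T i = 2 * deltaCount m i := fun i => by
    rw [P.embeddingCount_eq (hTree.connected.mono hT) hcard hT hTree,
      CaterpillarHalin.card_faceForm_eq_deltaCount]
  -- The rank is at most the size of the matrix, so truncating δ(z) loses nothing.
  have hzero : ∀ i, k + ∑ i, m i + 1 ≤ i → deltaCount m i = 0 := fun i hi => by
    rw [deltaCount, Set.ncard_eq_zero (Set.toFinite _), Set.eq_empty_iff_forall_notMem]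
    rintro A ⟨-, hA⟩
    have := A.rank_le_card_height
    simp only [Fintype.card_sum, Fintype.card_fin, Fintype.card_sigma] at this
    omega
  ext i
  rw [coeff_eulerGenusPolynomial, hcount, ← Nat.cast_ofNat (R := Polynomial ℕ),
    Polynomial.coeff_natCast_mul, deltaPolynomial]
  simp only [Polynomial.finsetSum_coeff, Polynomial.coeff_monomial, Finset.sum_ite_eq',
    Finset.mem_range]
  split_ifs with h
  · rfl
  · rw [hzero i (by omega)]
    rfl
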